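/- **Definitions.** A *building graph* is $G=\langle V,E,EX,c,d\rangle$ with a finite vertex set $V$, edges $E\subseteq V\times V$, exits $EX\subsetneq V$, and integer-valued capacity and travel-time functions $c,d:V\cup E\to\mathbb Z$ with $d(v)=0$ for every vertex $v$. Let $P$ be a finite set of people with $c(v)\ge |P|$ for all $v\in EX$, and let $T=\{0,\dots,t_{\max}\}$. A *state* is a map $P\to V\cup E$. Fix an initial state $s_0$. A *weak evacuation schedule* (WES) is a sequence of states $(es(t))_{t\in T}$ with $es(0)=s_0$ such that, writing $es_p(t)$ for the location of $p$ at time $t$, for every $p\in P$: (1) if $es_p(t)=v_1\in V$, then $es_p(t+1)$ is $v_1$, or an edge $(v_1,v_2)\in E$, or a vertex $v_2$ with $(v_1,v_2)\in E$; (2) if $es_p(t)=e=(v_1,v_2)\in E$, then $es_p(t+1)\in\{e,v_1,v_2\}$; (3) if $e=(v_1,v_2)\in E$, $es_p(t)=v_1$ and $es_p(t+k)=v_2$ with $k\ge 0$, then $d(e)\le k$; (4) if $es_p(t')\in EX$ and $t'<t''\le t_{\max}$, then $es_p(t'')=es_p(t')$. A *strong evacuation schedule* (SES) is a WES in which, at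 every time, at most $c(x)$ people are at each $x\in V\cup E$, and in which every person is at an exit at time $t_{\max}$. A *behavior model* $\beta$ assigns to every SES $es$ a probability distribution $\beta(es)$ on the set of WESs. For $D\le t_{\max}$ let $N_{es'}(D)=|\{p\in P: es'_p(D)\in EX\}|$ and $\mathbb E[N_{es}(D)]=\sum_{es'}\beta(es)(es')\,N_{es'}(D)$, the sum being over all WESs $es'$. **The problem DEP.** Given an evacuation framework $\langle G,s_0,\beta\rangle$, a deadline $D\le t_{\max}$ and a number $K\le|P|$ ($K\in\mathbb N$), decide whether there is an SES $es$ with $\mathbb E[N_{es}(D)]\ge K$. In the input the vertices, people and time points are listed, integers are written in binary, and $\beta$ is given succinctly: by a multi-stack machine program, together with a parameter string and a time bound in unary, which on each SES $es$ outputs within the time bound a list of WESs with rational weights that specifies the distribution $\beta(es)$. **Theorem.** DEP is NP-hard: every language in NP is reducible to DEP by a polynomial-time many-one reduction. -/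

import Mathlib

namespace Evac

open Turing

/-! ### Building graphs and evacuation schedules -/

/-- A building graph `⟨V, E, EX, c, d⟩` on the vertex set `V`.  The capacity `c` and the travel
time `d` are integer valued functions on `V ∪ E`, and vertices have travel time `0`. -/
structure BuildingGraph (V : Type) [Fintype V] where
  E : Finset (V × V)
  EX : Finset V
  EX_ssubset : EX ⊂ Finset.univ
  c : V ⊕ {e // e ∈ E} → ℤ
  d : V ⊕ {e // e ∈ E} → ℤ
  d_vertex : ∀ v, d (Sum.inl v) = 0

variable {V P : Type} [Fintype V] [Fintype P]

/-- The locations `V ∪ E`. -/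
abbrev BuildingGraph.Loc (G : BuildingGraph V) : Type := V ⊕ {e // e ∈ G.E}

/-- A state places every person at a vertex or on an edge. -/
abbrev State (G : BuildingGraph V) (P : Type) : Type := P → G.Loc

/-- A sequence of states indexed by the time points `0, …, tmax`. -/
abbrev Schedule (G : BuildingGraph V) (P : Type) (tmax : ℕ) : Type :=
  Fin (tmax + 1) → State G P

/-- The conditions on a weak evacuation schedule. -/
structure IsWES {G : BuildingGraph V} {tmax : ℕ} (es : Schedule G P tmax) : Prop where
  /-- From a vertex one stays, enters an edge leaving it, or moves along such an edge. -/
  from_vertex : ∀ (p : P) (t t' : Fin (tmax + 1)), (t' : ℕ) = t + 1 →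
    ∀ v : V, es t p = Sum.inl v →
      es t' p = Sum.inl v ∨
      (∃ e : {e // e ∈ G.E}, e.1.1 = v ∧ es t' p = Sum.inr e) ∨
      (∃ e : {e // e ∈ G.E}, e.1.1 = v ∧ es t' p = Sum.inl e.1.2)
  /-- From an edge one stays on it or moves to one of its endpoints. -/
  from_edge : ∀ (p : P) (t t' : Fin (tmax + 1)), (t' : ℕ) = t + 1 →
    ∀ e : {e // e ∈ G.E}, es t p = Sum.inr e →
      es t' p = Sum.inr e ∨ es t' p = Sum.inl e.1.1 ∨ es t' p = Sum.inl e.1.2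
  /-- For an edge `e = (v₁, v₂)`, a person at `v₁` is at `v₂` only after at least `d e` units. -/
  travel_time : ∀ (p : P) (e : {e // e ∈ G.E}) (t t' : Fin (tmax + 1)), t ≤ t' →
    es t p = Sum.inl e.1.1 → es t' p = Sum.inl e.1.2 →
      G.d (Sum.inr e) ≤ (t' : ℤ) - (t : ℤ)
  /-- Nobody leaves an exit. -/
  exit_absorbing : ∀ (p : P) (t' t'' : Fin (tmax + 1)), t' < t'' →
    ∀ v ∈ G.EX, es t' p = Sum.inl v → es t'' p = Sum.inl v

open Classical in
/-- The additional conditions on a strong evacuation schedule. -/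
structure IsSES {G : BuildingGraph V} {tmax : ℕ} (es : Schedule G P tmax) : Prop
    extends IsWES es where
  vertex_capacity : ∀ (t : Fin (tmax + 1)) (v : V),
    ((Finset.univ.filter fun p => es t p = Sum.inl v).card : ℤ) ≤ G.c (Sum.inl v)
  edge_capacity : ∀ (t : Fin (tmax + 1)) (e : {e // e ∈ G.E}),
    ((Finset.univ.filter fun p => es t p = Sum.inr e).card : ℤ) ≤ G.c (Sum.inr e)
  all_evacuated : ∀ p : P, ∃ v ∈ G.EX, es (Fin.last tmax) p = Sum.inl v

/-- The weak evacuation schedules that start in the state `s₀`. -/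
def WES (G : BuildingGraph V) (s₀ : State G P) (tmax : ℕ) : Type :=
  {es : Schedule G P tmax // IsWES es ∧ es 0 = s₀}

/-- The strong evacuation schedules that start in the state `s₀`. -/
def SES (G : BuildingGraph V) (s₀ : State G P) (tmax : ℕ) : Type :=
  {es : Schedule G P tmax // IsSES es ∧ es 0 = s₀}

noncomputable instance (G : BuildingGraph V) (s₀ : State G P) (tmax : ℕ) :
    Fintype (WES G s₀ tmax) :=
  haveI : Finite (WES G s₀ tmax) := by unfold WES; infer_instance
  Fintype.ofFinite _

/-- A behavior model sends every SES to a probability distribution `ω` on the set of WESs, that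
is, to a nonnegative function with sum `1`. -/
abbrev BehaviorModel (G : BuildingGraph V) (s₀ : State G P) (tmax : ℕ) : Type :=
  SES G s₀ tmax → stdSimplex ℝ (WES G s₀ tmax)

open Classical in
/-- The number of people evacuated by the deadline `D ≤ tmax`. -/
noncomputable def numEvacuated {G : BuildingGraph V} {tmax : ℕ} (es : Schedule G P tmax)
    (D : Fin (tmax + 1)) : ℕ :=
  (Finset.univ.filter fun p => ∃ v ∈ G.EX, es D p = Sum.inl v).card

/-- The expected number of people evacuated by `D` if the population is told to follow `es` and
behaves according to `β`.  (Schedules of probability zero contribute nothing to the sum.) -/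
noncomputable def expectedEvacuated {G : BuildingGraph V} {s₀ : State G P} {tmax : ℕ}
    (β : BehaviorModel G s₀ tmax) (es : SES G s₀ tmax) (D : Fin (tmax + 1)) : ℝ :=
  ∑ w : WES G s₀ tmax, (β es).1 w * (numEvacuated w.1 D : ℝ)

/-- An instance of DEP: an evacuation framework `⟨G, s₀, β⟩` with vertices `0, …, n - 1`, people
`0, …, m - 1` and time points `0, …, tmax`, in which every exit can hold all people, together
with a deadline `D ≤ tmax` and a number `K ≤ m`. -/
structure Instance where
  n : ℕ
  m : ℕ
  tmax : ℕ
  G : BuildingGraph (Fin n)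
  exit_capacity : ∀ v ∈ G.EX, (m : ℤ) ≤ G.c (Sum.inl v)
  s₀ : State G (Fin m)
  β : BehaviorModel G s₀ tmax
  D : Fin (tmax + 1)
  K : ℕ
  K_le : K ≤ m

/-- The question asked by DEP. -/
def Instance.IsYes (I : Instance) : Prop :=
  ∃ es : SES I.G I.s₀ I.tmax, (I.K : ℝ) ≤ expectedEvacuated I.β es I.D

/-! ### Encoding by strings

Every block below is self-delimiting. Numbers are written in binary (least significant digit
first); the sets of vertices, people and time points are listed, hence have unary size. -/

inductive Symbol
  | zero
  | one
  | lpar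
  | rpar

def encBit : Bool → Symbol
  | false => Symbol.zero
  | true => Symbol.one

def encBits (l : List Bool) : List Symbol := Symbol.lpar :: (l.map encBit ++ [Symbol.rpar])

def encNat (n : ℕ) : List Symbol := encBits n.bits

def encUnary (n : ℕ) : List Symbol := encBits (List.replicate n true)

def encInt : ℤ → List Symbol
  | Int.ofNat n => Symbol.zero :: encNat n
  | Int.negSucc n => Symbol.one :: encNat n

def encList {α : Type} (f : α → List Symbol) (l : List α) : List Symbol :=
  Symbol.lpar :: (l.flatMap f ++ [Symbol.rpar])

def encLoc {n : ℕ} {G : BuildingGraph (Fin n)} : G.Loc → List Symbol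
  | Sum.inl v => Symbol.zero :: encNat v
  | Sum.inr e => Symbol.one :: (encNat e.1.1 ++ encNat e.1.2)

def encState {n m : ℕ} {G : BuildingGraph (Fin n)} (s : State G (Fin m)) : List Symbol :=
  encList encLoc (List.ofFn s)

def encSchedule {n m tmax : ℕ} {G : BuildingGraph (Fin n)} (es : Schedule G (Fin m) tmax) :
    List Symbol :=
  encList encState (List.ofFn es)

/-- The list of vertices (capacity, exit or not) and the adjacency matrix, whose nonzero entries
carry the capacity and the travel time of the edge. -/
def encGraph {n : ℕ} (G : BuildingGraph (Fin n)) : List Symbol :=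
  encList (fun v => encBit (decide (v ∈ G.EX)) :: encInt (G.c (Sum.inl v))) (List.finRange n) ++
  encList (fun u => encList (fun v =>
      if h : (u, v) ∈ G.E then
        Symbol.one :: (encInt (G.c (Sum.inr ⟨(u, v), h⟩)) ++ encInt (G.d (Sum.inr ⟨(u, v), h⟩)))
      else [Symbol.zero])
    (List.finRange n)) (List.finRange n)

/-! ### Finite descriptions of behavior models

The set of SESs is in general exponentially large, so a behavior model is specified succinctly:
by a program that computes, for a given SES, the list of WESs of positive probability with their
probabilities.  The program comes with a bound on its running time, written in unary. -/

/-- Instructions of a machine with finitely many stacks. -/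
inductive Instr
  /-- Push the symbol `a` on stack `k` and go to instruction `next`. -/
  | push (k a next : ℕ)
  /-- Pop stack `k`: go to `onEmpty` if it is empty, otherwise to the entry of `onSymbol` whose
  index is the symbol that was removed. -/
  | pop (k onEmpty : ℕ) (onSymbol : List ℕ)

/-- A configuration: the current instruction and the contents of the stacks, top first. -/
structure Config where
  pc : ℕ
  stk : ℕ → List ℕ

/-- One step of a program.  The program has halted once `pc` is not the index of an
instruction. -/
def step (code : List Instr) (C : Config) : Config :=
  match code[C.pc]? with
  | none => C
  | some (Instr.push k a next) => ⟨next, Function.update C.stk k (a :: C.stk k)⟩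
  | some (Instr.pop k onEmpty onSymbol) =>
    match C.stk k with
    | [] => ⟨onEmpty, C.stk⟩
    | a :: r => ⟨onSymbol.getD a code.length, Function.update C.stk k r⟩

def Symbol.toNat : Symbol → ℕ
  | zero => 0
  | one => 1
  | lpar => 2
  | rpar => 3

/-- A program, a string of parameters available to it, and a bound on its running time. -/
structure BehaviorCode where
  code : List Instr
  data : List Bool
  clock : ℕ

/-- Initially the input is on stack `0`, the parameters are on stack `1`, and all other stacks
are empty. -/
def BehaviorCode.init (B : BehaviorCode) (input : List Symbol) : Config where
  pc := 0
  stk k :=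
    if k = 0 then input.map Symbol.toNat
    else if k = 1 then B.data.map Bool.toNat
    else []

/-- On the given input the program halts after at most `B.clock` steps, with the given output on
stack `2`. -/
def BehaviorCode.Outputs (B : BehaviorCode) (input output : List Symbol) : Prop :=
  let C := (step B.code)^[B.clock] (B.init input)
  B.code.length ≤ C.pc ∧ C.stk 2 = output.map Symbol.toNat

open Classical in
/-- `B` describes `β`: given any SES `es`, it outputs a list of pairs (probability, WES) that
specifies the distribution `β es`. -/
def BehaviorCode.Describes (B : BehaviorCode) {n m tmax : ℕ} {G : BuildingGraph (Fin n)}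
    {s₀ : State G (Fin m)} (β : BehaviorModel G s₀ tmax) : Prop :=
  ∀ es : SES G s₀ tmax, ∃ l : List (ℚ≥0 × WES G s₀ tmax),
    B.Outputs (encSchedule es.1)
      (encList (fun x => encNat x.1.num ++ (encNat x.1.den ++ encSchedule x.2.1)) l) ∧
    ∀ w : WES G s₀ tmax, (β es).1 w = (l.map fun x => if x.2 = w then (x.1 : ℝ) else 0).sum

def encInstr : Instr → List Symbol
  | Instr.push k a next => Symbol.zero :: (encNat k ++ (encNat a ++ encNat next))
  | Instr.pop k onEmpty onSymbol =>
    Symbol.one :: (encNat k ++ (encNat onEmpty ++ encList encNat onSymbol))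

def BehaviorCode.enc (B : BehaviorCode) : List Symbol :=
  encList encInstr B.code ++ (encBits B.data ++ encUnary B.clock)

/-- The string for the instance `I`, whose behavior model is described by `B`. -/
def Instance.enc (I : Instance) (B : BehaviorCode) : List Symbol :=
  encGraph I.G ++ (encState I.s₀ ++ (encUnary I.tmax ++ (encNat I.D ++ (encNat I.K ++ B.enc))))

/-- The decision problem DEP: the set of strings that encode its yes-instances. -/
def DEP : Language Symbol :=
  {s | ∃ (I : Instance) (B : BehaviorCode), B.Describes I.β ∧ I.enc B = s ∧ I.IsYes}

/-! ### NP-hardness -/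

/-- The string `x#w`. -/
def encPair (xw : List Bool × List Bool) : List (Option Bool) :=
  xw.1.map some ++ none :: xw.2.map some

/-- `L` is in NP: membership is witnessed by certificates of polynomial length that are checked
by a Turing machine in polynomial time. -/
def InNP (L : Language Bool) : Prop :=
  ∃ (p : Polynomial ℕ) (verify : List Bool × List Bool → Bool),
    Nonempty (TM2ComputableInPolyTime encPair Computability.encodeBool verify) ∧
    ∀ x : List Bool, x ∈ L ↔ ∃ w : List Bool, w.length ≤ p.eval x.length ∧ verify (x, w) = true

/-- Polynomial-time many-one (Karp) reducibility. -/
def PolyTimeReducible {Γ Δ : Type} (L : Language Γ) (A : Language Δ) : Prop :=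
  ∃ f : List Γ → List Δ,
    Nonempty (TM2ComputableInPolyTime (id : List Γ → List Γ) (id : List Δ → List Δ) f) ∧
    ∀ x : List Γ, x ∈ L ↔ f x ∈ A

def NPHard {Δ : Type} (A : Language Δ) : Prop :=
  ∀ L : Language Bool, InNP L → PolyTimeReducible L A

end Evac

namespace Evac

open Turing

/-! Let `L` be in NP, with a verifier that accepts certificates of length at most `p |x|`. The
building has two rooms `0` and `1` and an exit `2`, every two of them joined; there is one person,
and `p |x| + 1` time steps. The rooms that the person visits spell a bit string, so a strong
evacuation schedule is nothing but a guess of a certificate. The behavior model runs the verifier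
on `x` and that certificate; if it accepts, then the person leaves at time `1`, and otherwise
never. Hence some schedule has an expected number of one evacuee at the deadline `1` if and only
if `x ∈ L`.

The verifier becomes part of the *program* of the instance, which is fixed, while `x` becomes its
parameter; apart from that only numbers in unary depend on `x`. So the reduction merely prints
constant strings, the bits of `x` and polynomials in `|x|` in unary. That a string in DEP might be
read as another instance is excluded by the unique readability of the encoding. -/

/-! ### A structured language for stack machines -/

/-- Structured programs over stacks indexed by `K`, stack `k` holding symbols from `Γ k`.
`pop k e f` pops stack `k` and continues with `e` if it was empty and with `f a` if the symbol
`a` was removed; `loop k f` pops stack `k` until it is empty, running `f a` for each symbol. -/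
inductive Cmd {K : Type} (Γ : K → Type) : Type
  | skip
  | push (k : K) (a : Γ k)
  | seq (c d : Cmd Γ)
  | pop (k : K) (e : Cmd Γ) (f : Γ k → Cmd Γ)
  | loop (k : K) (f : Γ k → Cmd Γ)

/-- The contents of the stacks, top first. -/
abbrev Store {K : Type} (Γ : K → Type) : Type := ∀ k, List (Γ k)

/-- `ReachesWithin f a t b`: at most `t` applications of `f` lead from `a` to `b`. -/
def ReachesWithin {α : Type} (f : α → α) (a : α) (t : ℕ) (b : α) : Prop :=
  ∃ n ≤ t, f^[n] a = b

section ReachesWithin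

variable {α : Type} {f : α → α} {a b c : α} {t u : ℕ}

theorem ReachesWithin.refl (f : α → α) (a : α) : ReachesWithin f a 0 a := ⟨0, le_rfl, rfl⟩

theorem ReachesWithin.single (h : f a = b) : ReachesWithin f a 1 b := ⟨1, le_rfl, h⟩

theorem ReachesWithin.mono (h : ReachesWithin f a t b) (htu : t ≤ u) : ReachesWithin f a u b :=
  let ⟨n, hn, h⟩ := h
  ⟨n, hn.trans htu, h⟩

theorem ReachesWithin.trans (h : ReachesWithin f a t b) (h' : ReachesWithin f b u c) :
    ReachesWithin f a (t + u) c := by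
  obtain ⟨m, hm, rfl⟩ := h
  obtain ⟨n, hn, rfl⟩ := h'
  exact ⟨n + m, by omega, Function.iterate_add_apply f n m a⟩

theorem ReachesWithin.iterate_eq (h : ReachesWithin f a t b) (hb : f b = b) : f^[t] a = b := by
  obtain ⟨n, hn, rfl⟩ := h
  rw [← Nat.sub_add_cancel hn, Function.iterate_add_apply, Function.iterate_fixed hb]

end ReachesWithin

section Language

variable {K : Type} {Γ : K → Type} [DecidableEq K]

/-- `RunsWithin c S t S'`: started with the stacks `S`, the program `c` ends with the stacks `S'`
after at most `t` elementary operations. -/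
inductive RunsWithin : Cmd Γ → Store Γ → ℕ → Store Γ → Prop
  | skip (S) : RunsWithin .skip S 0 S
  | push (S k a) : RunsWithin (.push k a) S 1 (Function.update S k (a :: S k))
  | seq {c d S t S' u S''} (h : RunsWithin c S t S') (h' : RunsWithin d S' u S'') :
      RunsWithin (.seq c d) S (t + u) S''
  | pop_nil {k e f S t S'} (hk : S k = []) (h : RunsWithin e S t S') :
      RunsWithin (.pop k e f) S (1 + t) S'
  | pop_cons {k e f S a r t S'} (hk : S k = a :: r)
      (h : RunsWithin (f a) (Function.update S k r) t S') : RunsWithin (.pop k e f) S (1 + t) S'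
  | loop_nil {k f S} (hk : S k = []) : RunsWithin (.loop k f) S 1 S
  | loop_cons {k f S a r t S' u S''} (hk : S k = a :: r)
      (h : RunsWithin (f a) (Function.update S k r) t S') (h' : RunsWithin (.loop k f) S' u S'') :
      RunsWithin (.loop k f) S (1 + (t + u)) S''
  | mono {c S t S' u} (h : RunsWithin c S t S') (htu : t ≤ u) : RunsWithin c S u S'

theorem RunsWithin.congr {c : Cmd Γ} {S S' R R' : Store Γ} {t u : ℕ} (h : RunsWithin c S t S')
    (hS : R = S) (hS' : S' = R') (htu : t ≤ u) : RunsWithin c R u R' := by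
  subst hS hS'
  exact h.mono htu

/-- A loop is a left fold: `I l s` is the store in which stack `k` holds `l` and the state of the
fold is `s`. -/
theorem RunsWithin.loop {σ : Type} {k : K} {f : Γ k → Cmd Γ} {t : ℕ}
    (I : List (Γ k) → σ → Store Γ) (g : σ → Γ k → σ)
    (hI : ∀ l r s, Function.update (I l s) k r = I r s)
    (hf : ∀ a r s, RunsWithin (f a) (I r s) t (I r (g s a))) (l : List (Γ k)) (s : σ) :
    RunsWithin (.loop k f) (I l s) ((t + 1) * l.length + 1) (I [] (l.foldl g s)) := by
  have hk (l s) : I l s k = l := by rw [← hI l l s, Function.update_self]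
  induction l generalizing s with
  | nil => exact (loop_nil (hk [] s)).mono le_add_self
  | cons a r ih =>
    refine (loop_cons (hk (a :: r) s) ?_ (ih (g s a))).mono (t := 1 + (t + _)) ?_
    · rw [hI]
      exact hf a r s
    · rw [List.length_cons]
      linarith

/-- Push the string `l`, so that its first symbol ends up on top. -/
def Cmd.pushAll (k : K) (l : List (Γ k)) : Cmd Γ := l.foldr (fun a c => .seq c (.push k a)) .skip

theorem runsWithin_pushAll (k : K) (l : List (Γ k)) (S : Store Γ) :
    RunsWithin (.pushAll k l) S l.length (Function.update S k (l ++ S k)) := by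
  induction l with
  | nil => simpa [Cmd.pushAll] using RunsWithin.skip S
  | cons a l ih => simpa [Cmd.pushAll] using ih.seq (RunsWithin.push _ k a)

end Language

/-! ### Flow graphs -/

section FlowGraph

variable {K : Type} {Γ : K → Type} {L L' L'' : Type}

/-- An operation of a flow graph with labels `L`. -/
inductive FlowOp (Γ : K → Type) (L : Type) : Type
  | push (k : K) (a : Γ k) (next : L)
  | pop (k : K) (e : L) (f : Γ k → L)

/-- Renaming of labels. -/
def FlowOp.map (g : L → L') : FlowOp Γ L → FlowOp Γ L'
  | push k a next => push k a (g next)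
  | pop k e f => pop k (g e) (g ∘ f)

theorem FlowOp.map_map (g : L → L') (g' : L' → L'') (o : FlowOp Γ L) :
    (o.map g).map g' = o.map (g' ∘ g) := by
  cases o <;> rfl

theorem FlowOp.map_id (o : FlowOp Γ L) : o.map id = o := by
  cases o <;> rfl

variable [DecidableEq K]

/-- The effect of an operation: the next label and the new stacks. -/
def FlowOp.exec : FlowOp Γ L → Store Γ → L × Store Γ
  | push k a next, S => (next, Function.update S k (a :: S k))
  | pop k e f, S =>
    match S k with
    | [] => (e, S)
    | a :: r => (f a, Function.update S k r)

/-- A flow graph assigns an operation to every label; the label `none` is its exit. -/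
abbrev FlowGraph (Γ : K → Type) (L : Type) : Type := L → FlowOp Γ (Option L)

/-- One step of a flow graph. -/
def FlowGraph.step (G : FlowGraph Γ L) : Option L × Store Γ → Option L × Store Γ
  | (none, S) => (none, S)
  | (some l, S) => (G l).exec S

/-- The label that `o` becomes when a flow graph is embedded into another one by `ι`, with its
exit redirected to `x`. -/
def link (x : Option L) (ι : L' → L) (o : Option L') : Option L := o.elim x (some ∘ ι)

@[simp] theorem link_none (x : Option L) (ι : L' → L) : link x ι none = x := rfl

@[simp] theorem link_some (x : Option L) (ι : L' → L) (l : L') : link x ι (some l) = some (ι l) :=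
  rfl

theorem link_none_id : link none (id : L → L) = id := by
  funext o
  cases o <;> rfl

theorem link_link (x : Option L) (ι : L' → L) (y : Option L') (κ : L'' → L') (o : Option L'') :
    link x ι (link y κ o) = link (link x ι y) (ι ∘ κ) o := by
  cases o <;> rfl

theorem link_comp_link (x : Option L) (ι : L' → L) (y : Option L') (κ : L'' → L') :
    link x ι ∘ link y κ = link (link x ι y) (ι ∘ κ) :=
  funext (link_link x ι y κ)

end FlowGraph

section Compilation

variable {K : Type} {Γ : K → Type}

/-- The labels of the flow graph of a program. -/
inductive Cmd.Label : Cmd Γ → Type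
  | push {k a} : Label (.push k a)
  | left {c d} (l : Label c) : Label (.seq c d)
  | right {c d} (l : Label d) : Label (.seq c d)
  | popHead {k e f} : Label (.pop k e f)
  | popNil {k e f} (l : Label e) : Label (.pop k e f)
  | popCons {k e f} (a : Γ k) (l : Label (f a)) : Label (.pop k e f)
  | loopHead {k f} : Label (.loop k f)
  | loopBody {k f} (a : Γ k) (l : Label (f a)) : Label (.loop k f)

instance Cmd.finite_label [∀ k, Finite (Γ k)] (c : Cmd Γ) : Finite c.Label := by
  induction c with
  | skip => exact Finite.of_injective (β := Empty) (fun l => nomatch l) (fun l => nomatch l)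
  | push k a =>
    exact Finite.of_surjective (α := Unit) (fun _ => .push) (fun | .push => ⟨(), rfl⟩)
  | seq c d hc hd =>
    exact Finite.of_surjective (α := c.Label ⊕ d.Label) (Sum.elim .left .right)
      (fun | .left l => ⟨.inl l, rfl⟩ | .right l => ⟨.inr l, rfl⟩)
  | pop k e f he hf =>
    exact Finite.of_surjective (α := Option (e.Label ⊕ Σ a, (f a).Label))
      (fun o => o.elim .popHead (Sum.elim .popNil fun p => .popCons p.1 p.2))
      (fun
        | .popHead => ⟨none, rfl⟩
        | .popNil l => ⟨some (.inl l), rfl⟩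
        | .popCons a l => ⟨some (.inr ⟨a, l⟩), rfl⟩)
  | loop k f hf =>
    exact Finite.of_surjective (α := Option (Σ a, (f a).Label))
      (fun o => o.elim .loopHead fun p => .loopBody p.1 p.2)
      (fun | .loopHead => ⟨none, rfl⟩ | .loopBody a l => ⟨some ⟨a, l⟩, rfl⟩)

/-- The label at which a program starts; `none` if there is nothing to do. -/
def Cmd.entry : (c : Cmd Γ) → Option c.Label
  | skip => none
  | push _ _ => some .push
  | seq c d => link (link none .right d.entry) .left c.entry
  | pop _ _ _ => some .popHead
  | loop _ _ => some .loopHead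

/-- The flow graph of a program. -/
def Cmd.flow : {c : Cmd Γ} → FlowGraph Γ c.Label
  | _, .push (k := k) (a := a) => .push k a none
  | _, .left (d := d) l => (flow l).map (link (link none .right d.entry) .left)
  | _, .right l => (flow l).map (link none .right)
  | _, .popHead (k := k) (e := e) (f := f) =>
    .pop k (link none .popNil e.entry) fun a => link none (.popCons a) (f a).entry
  | _, .popNil l => (flow l).map (link none .popNil)
  | _, .popCons a l => (flow l).map (link none (.popCons a))
  | _, .loopHead (k := k) (f := f) =>
    .pop k none fun a => link (some .loopHead) (.loopBody a) (f a).entry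
  | _, .loopBody a l => (flow l).map (link (some .loopHead) (.loopBody a))

variable [DecidableEq K]

theorem RunsWithin.reachesWithin_of_embedding {c : Cmd Γ} {S S' : Store Γ} {t : ℕ}
    (h : RunsWithin c S t S') {L : Type} (G : FlowGraph Γ L) (ι : c.Label → L) (x : Option L)
    (hG : ∀ l, G (ι l) = (Cmd.flow l).map (link x ι)) :
    ReachesWithin G.step (link x ι c.entry, S) t (x, S') := by
  induction h generalizing x with
  | skip S => exact .refl _ _
  | push S k a => exact .single (by simp [FlowGraph.step, Cmd.entry, hG, Cmd.flow,
      FlowOp.map, FlowOp.exec])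
  | @seq c d S t S' u S'' _ _ ih ih' =>
    simp only [Cmd.entry, link_link, link_none]
    exact (ih (ι ∘ .left) (link x (ι ∘ .right) d.entry) fun l => by
      simp [hG, Cmd.flow, FlowOp.map_map, link_comp_link, link_link]).trans
      (ih' (ι ∘ .right) x fun l => by
        simp [hG, Cmd.flow, FlowOp.map_map, link_comp_link])
  | @pop_nil k e f S t S' hk _ ih =>
    refine .trans (.single ?_) (ih (ι ∘ .popNil) x fun l => by
      simp [hG, Cmd.flow, FlowOp.map_map, link_comp_link])
    simp [FlowGraph.step, Cmd.entry, hG, Cmd.flow, FlowOp.map, FlowOp.exec, hk, link_link]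
  | @pop_cons k e f S a r t S' hk _ ih =>
    refine .trans (.single ?_) (ih (ι ∘ .popCons a) x fun l => by
      simp [hG, Cmd.flow, FlowOp.map_map, link_comp_link])
    simp [FlowGraph.step, Cmd.entry, hG, Cmd.flow, FlowOp.map, FlowOp.exec, hk, link_link]
  | @loop_nil k f S hk =>
    exact .single (by
      simp [FlowGraph.step, Cmd.entry, hG, Cmd.flow, FlowOp.map, FlowOp.exec, hk])
  | @loop_cons k f S a r t S' u S'' hk _ _ ih ih' =>
    refine .trans (.single ?_) ((ih (ι ∘ .loopBody a) (some (ι .loopHead)) fun l => by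
      simp [hG, Cmd.flow, FlowOp.map_map, link_comp_link]).trans (ih' ι x hG))
    simp [FlowGraph.step, Cmd.entry, hG, Cmd.flow, FlowOp.map, FlowOp.exec, hk, link_link]
  | mono _ htu ih => exact (ih ι x hG).mono htu

theorem RunsWithin.reachesWithin {c : Cmd Γ} {S S' : Store Γ} {t : ℕ} (h : RunsWithin c S t S') :
    ReachesWithin (Cmd.flow (c := c)).step (c.entry, S) t (none, S') := by
  simpa only [link_none_id, id] using
    h.reachesWithin_of_embedding Cmd.flow id none (by simp [link_none_id, FlowOp.map_id])

end Compilation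

/-! ### Flow graphs as Turing machines -/

section TuringMachine

variable {K : Type} [DecidableEq K] {Γ : K → Type} {L : Type}

/-- The store with the string `x` on stack `k` and nothing else. -/
def Store.single (k : K) (x : List (Γ k)) : Store Γ := Function.update (fun _ => []) k x

theorem initList_eq (tm : FinTM2) (s : List (tm.Γ tm.k₀)) :
    initList tm s = ⟨some tm.main, tm.initialState, Store.single tm.k₀ s⟩ := by
  refine congrArg (TM2.Cfg.mk _ _) (funext fun k => ?_)
  by_cases hk : k = tm.k₀
  · subst hk; simp [Store.single]
  · simp [Store.single, hk]

theorem haltList_eq (tm : FinTM2) (s : List (tm.Γ tm.k₁)) :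
    haltList tm s = ⟨none, tm.initialState, Store.single tm.k₁ s⟩ := by
  refine congrArg (TM2.Cfg.mk _ _) (funext fun k => ?_)
  by_cases hk : k = tm.k₁
  · subst hk; simp [Store.single]
  · simp [Store.single, hk]

/-- A flow graph operation as a Turing machine statement; the next label is kept in the internal
state of the machine. -/
def FlowOp.toStmt : FlowOp Γ L → TM2.Stmt Γ L L
  | push k a next => .push k (fun _ => a) (.goto fun _ => next)
  | pop k e f => .pop k (fun _ o => o.elim e f) (.goto id)

/-- The statements of the Turing machine of a flow graph. Before halting it restores its internal
state, as `haltList` requires. -/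
def FlowGraph.toStmt (G : FlowGraph Γ L) : Option L → TM2.Stmt Γ (Option L) (Option L)
  | none => .load (fun _ => none) .halt
  | some l => (G l).toStmt

theorem FlowOp.stepAux_toStmt (o : FlowOp Γ L) (v : L) (S : Store Γ) :
    ∃ v', TM2.stepAux o.toStmt v S = ⟨some (o.exec S).1, v', (o.exec S).2⟩ := by
  cases o with
  | push k a next => exact ⟨v, rfl⟩
  | pop k e f =>
    cases hk : S k with
    | nil =>
      have hS : Function.update S k [] = S := by rw [← hk, Function.update_eq_self]
      exact ⟨e, by simp [toStmt, exec, hk, hS]⟩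
    | cons a r => exact ⟨f a, by simp [toStmt, exec, hk]⟩

theorem FlowGraph.evals_toStmt (G : FlowGraph Γ L) {n : ℕ} {o v : Option L} {S S' : Store Γ}
    (h : G.step^[n] (o, S) = (none, S')) :
    ∃ m ≤ n + 1, (flip bind (TM2.step G.toStmt))^[m] (some ⟨some o, v, S⟩) =
      some ⟨none, none, S'⟩ := by
  induction n generalizing o v S with
  | zero =>
    obtain ⟨rfl, rfl⟩ : o = none ∧ S = S' := by simpa using h
    exact ⟨1, le_rfl, rfl⟩
  | succ n ih =>
    cases o with
    | none =>
      have hfixed : G.step^[n + 1] (none, S) = (none, S) := Function.iterate_fixed rfl _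
      obtain rfl : S = S' := by simpa using hfixed.symm.trans h
      exact ⟨1, by simp, rfl⟩
    | some l =>
      obtain ⟨v', hv⟩ := (G l).stepAux_toStmt v S
      obtain ⟨m, hm, h'⟩ := ih (v := v') h
      exact ⟨m + 1, by omega, (congrArg (fun C => _^[m] (some C)) hv).trans h'⟩

/-- The Turing machine of a flow graph that starts at the label `start`, reads its input from
stack `i` and leaves its output on stack `o`. -/
def FlowGraph.toFinTM2 [Fintype K] [Fintype L] (G : FlowGraph Γ L) (start : Option L) (i o : K)
    [Fintype (Γ i)] : FinTM2 where
  K := K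
  k₀ := i
  k₁ := o
  Γ := Γ
  Λ := Option L
  main := start
  σ := Option L
  initialState := none
  m := G.toStmt

theorem FlowGraph.polyTime [Finite K] [Finite L] (G : FlowGraph Γ L) (start : Option L) (i o : K)
    [Finite (Γ i)] (T : Polynomial ℕ) (f : List (Γ i) → List (Γ o))
    (h : ∀ x, ReachesWithin G.step (start, .single i x) (T.eval x.length)
      (none, .single o (f x))) :
    Nonempty (TM2ComputableInPolyTime (id : List (Γ i) → _) (id : List (Γ o) → _) f) := by
  have : Fintype K := Fintype.ofFinite K
  have : Fintype L := Fintype.ofFinite L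
  have : Fintype (Γ i) := Fintype.ofFinite (Γ i)
  refine ⟨⟨⟨G.toFinTM2 start i o, Equiv.refl _, Equiv.refl _⟩, T + 1,
    fun x => Classical.choice ?_⟩⟩
  obtain ⟨n, hn, hr⟩ := h x
  obtain ⟨m, hm, he⟩ := G.evals_toStmt (v := none) hr
  refine ⟨⟨⟨m, ?_⟩, ?_⟩⟩
  · rw [initList_eq, Option.map_some, haltList_eq]
    change (flip bind (TM2.step G.toStmt))^[m]
      (some ⟨some start, none, Store.single i (x.map id)⟩) =
        some ⟨none, none, Store.single o ((f x).map id)⟩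
    simpa only [List.map_id] using he
  · simpa using hm.trans (Nat.succ_le_succ hn)

theorem polyTime_of_runsWithin [Finite K] [∀ k, Finite (Γ k)] (c : Cmd Γ) (i o : K)
    (T : Polynomial ℕ) (f : List (Γ i) → List (Γ o))
    (h : ∀ x, RunsWithin c (.single i x) (T.eval x.length) (.single o (f x))) :
    Nonempty (TM2ComputableInPolyTime (id : List (Γ i) → _) (id : List (Γ o) → _) f) :=
  Cmd.flow.polyTime c.entry i o T f fun x => (h x).reachesWithin

end TuringMachine

/-! ### Flow graphs as instruction lists -/

/-- A list whose entry at the code `τ a` of the symbol `a` is `g a`. -/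
noncomputable def jumpTable {A : Type} (τ g : A → ℕ) : List ℕ :=
  (List.range (sSup (Set.range τ) + 1)).map (Function.extend τ g 0)

theorem getD_jumpTable {A : Type} [Finite A] {τ : A → ℕ} (hτ : Function.Injective τ) (g : A → ℕ)
    (a : A) (d : ℕ) : (jumpTable τ g).getD (τ a) d = g a := by
  have ha : τ a ≤ sSup (Set.range τ) := le_csSup (Set.finite_range τ).bddAbove ⟨a, rfl⟩
  simp [jumpTable, List.getD_eq_getElem?_getD, Nat.lt_succ_of_le ha, hτ.extend_apply]

section Instructions

variable {K : Type} {Γ : K → Type} {L : Type}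

/-- The numbers by which instructions refer to the stacks `K` and to their symbols. -/
structure Numbering (Γ : K → Type) where
  stack : K → ℕ
  symbol : ∀ k, Γ k → ℕ
  stack_injective : Function.Injective stack
  symbol_injective : ∀ k, Function.Injective (symbol k)

/-- The numbered stacks `s` hold the contents of the store `S`. -/
def Numbering.Represents (N : Numbering Γ) (s : ℕ → List ℕ) (S : Store Γ) : Prop :=
  ∀ k, s (N.stack k) = (S k).map (N.symbol k)

theorem Numbering.Represents.update [DecidableEq K] {N : Numbering Γ} {s : ℕ → List ℕ}
    {S : Store Γ} (h : N.Represents s S) (k : K) (l : List (Γ k)) :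
    N.Represents (Function.update s (N.stack k) (l.map (N.symbol k))) (Function.update S k l) := by
  intro j
  by_cases hj : j = k
  · subst hj; simp
  · simp [hj, N.stack_injective.ne hj, h j]

/-- The instruction for a flow graph operation, given the addresses of the labels. -/
noncomputable def FlowOp.toInstr (N : Numbering Γ) (addr : L → ℕ) : FlowOp Γ L → Instr
  | push k a next => .push (N.stack k) (N.symbol k a) (addr next)
  | pop k e f => .pop (N.stack k) (addr e) (jumpTable (N.symbol k) (addr ∘ f))

/-- The address of a label in a program that lists the operations of `labels`; the exit is the
first address after the program. -/
def address [DecidableEq L] (labels : List L) (o : Option L) : ℕ :=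
  o.elim labels.length labels.idxOf

/-- The instructions for the operations of a flow graph at the given labels. -/
noncomputable def FlowGraph.code [DecidableEq L] (G : FlowGraph Γ L) (N : Numbering Γ)
    (labels : List L) : List Instr :=
  labels.map fun l => (G l).toInstr N (address labels)

/-- `C` is at the address of the label `X.1`, and its stacks hold the contents of `X.2`. -/
def Numbering.RepresentsConfig [DecidableEq L] (N : Numbering Γ) (labels : List L)
    (C : Config) (X : Option L × Store Γ) : Prop :=
  C.pc = address labels X.1 ∧ N.Represents C.stk X.2

variable [DecidableEq K] [∀ k, Finite (Γ k)]

theorem Numbering.RepresentsConfig.step [DecidableEq L] {N : Numbering Γ} {labels : List L}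
    (hlabels : ∀ l, l ∈ labels) (G : FlowGraph Γ L) {C : Config} {X : Option L × Store Γ}
    (h : N.RepresentsConfig labels C X) :
    N.RepresentsConfig labels (step (G.code N labels) C) (G.step X) := by
  obtain ⟨pc, s⟩ := C
  obtain ⟨o, S⟩ := X
  obtain ⟨rfl, hs : N.Represents s S⟩ := h
  cases o with
  | none => simpa [Evac.step, FlowGraph.code, address, FlowGraph.step] using ⟨rfl, hs⟩
  | some l =>
    have hcode : (G.code N labels)[address labels (some l)]? =
        some ((G l).toInstr N (address labels)) := by
      simp [FlowGraph.code, address, List.getElem?_idxOf (hlabels l)]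
    simp only [Evac.step, hcode, FlowGraph.step]
    cases G l with
    | push k a next =>
      refine ⟨rfl, ?_⟩
      simpa [FlowOp.toInstr, FlowOp.exec, hs k] using hs.update k (a :: S k)
    | pop k e f =>
      cases hk : S k with
      | nil => simpa [FlowOp.toInstr, FlowOp.exec, hs k, hk] using ⟨rfl, hs⟩
      | cons a r =>
        simp only [FlowOp.toInstr, FlowOp.exec, hs k, hk, List.map_cons,
          getD_jumpTable (N.symbol_injective k)]
        exact ⟨rfl, hs.update k r⟩

theorem Numbering.RepresentsConfig.iterate [DecidableEq L] {N : Numbering Γ} {labels : List L}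
    (hlabels : ∀ l, l ∈ labels) (G : FlowGraph Γ L) {C : Config} {X : Option L × Store Γ}
    (h : N.RepresentsConfig labels C X) (t : ℕ) :
    N.RepresentsConfig labels ((Evac.step (G.code N labels))^[t] C) (G.step^[t] X) := by
  induction t with
  | zero => exact h
  | succ t ih =>
    rw [Function.iterate_succ_apply', Function.iterate_succ_apply']
    exact ih.step hlabels G

theorem FlowGraph.exists_code [Finite L] (G : FlowGraph Γ L) (N : Numbering Γ) (start : L) :
    ∃ code : List Instr, ∀ S S' t s, ReachesWithin G.step (some start, S) t (none, S') →
      N.Represents s S → code.length ≤ ((Evac.step code)^[t] ⟨0, s⟩).pc ∧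
        N.Represents ((Evac.step code)^[t] ⟨0, s⟩).stk S' := by
  classical
  have : Fintype L := Fintype.ofFinite L
  let labels : List L := start :: Finset.univ.toList
  refine ⟨G.code N labels, fun S S' t s h hs => ?_⟩
  have h0 : N.RepresentsConfig labels ⟨0, s⟩ (some start, S) := ⟨by simp [labels, address], hs⟩
  have ht := h0.iterate (by simp [labels]) G t
  rw [h.iterate_eq rfl] at ht
  exact ⟨by rw [ht.1]; simp [address, FlowGraph.code], ht.2⟩

end Instructions

/-! ### Turing machines as structured programs -/

section Frame

variable {K K' : Type} {Γ : K → Type} {Δ : K' → Type}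

/-- The program `c` on the first part of a disjoint union of two sets of stacks. -/
def Cmd.inl : Cmd Γ → Cmd (Sum.elim Γ Δ)
  | skip => .skip
  | push k a => .push (Sum.inl k) a
  | seq c d => .seq c.inl d.inl
  | pop k e f => .pop (Sum.inl k) e.inl fun a => (f a).inl
  | loop k f => .loop (Sum.inl k) fun a => (f a).inl

/-- The union of two stores. -/
def Store.sum (S : Store Γ) (R : Store Δ) : Store (Sum.elim Γ Δ) := Sum.rec S R

variable [DecidableEq K] [DecidableEq K']

theorem Store.update_inl (S : Store Γ) (R : Store Δ) (k : K) (l : List (Γ k)) :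
    Function.update (S.sum R) (Sum.inl k) l = Store.sum (Function.update S k l) R :=
  (Sum.rec_update_left (γ := fun j => List (Sum.elim Γ Δ j)) S R k l).symm

theorem Store.update_inr (S : Store Γ) (R : Store Δ) (k : K') (l : List (Δ k)) :
    Function.update (S.sum R) (Sum.inr k) l = S.sum (Function.update R k l) :=
  (Sum.rec_update_right (γ := fun j => List (Sum.elim Γ Δ j)) S R k l).symm

theorem RunsWithin.inl {c : Cmd Γ} {S S' : Store Γ} {t : ℕ} (h : RunsWithin c S t S')
    (R : Store Δ) : RunsWithin (c.inl (Δ := Δ)) (S.sum R) t (S'.sum R) := by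
  induction h with
  | skip S => exact .skip _
  | push S k a =>
    rw [← Store.update_inl]
    exact .push (S.sum R) (Sum.inl k) a
  | seq _ _ ih ih' => exact ih.seq ih'
  | pop_nil hk _ ih => exact .pop_nil hk ih
  | pop_cons hk _ ih => exact .pop_cons (k := Sum.inl _) hk (by rwa [Store.update_inl])
  | loop_nil hk => exact .loop_nil hk
  | loop_cons hk _ _ ih ih' => exact .loop_cons (k := Sum.inl _) hk (by rwa [Store.update_inl]) ih'
  | mono _ htu ih => exact ih.mono htu

end Frame

section Statements

variable {K : Type} {Γ : K → Type} {Λ σ : Type}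

/-- The symbols, with their stacks, that a statement may push. -/
def pushedSymbols : TM2.Stmt Γ Λ σ → Set (Σ k, Γ k)
  | .push k f q => Set.range (fun v => ⟨k, f v⟩) ∪ pushedSymbols q
  | .peek _ _ q => pushedSymbols q
  | .pop _ _ q => pushedSymbols q
  | .load _ q => pushedSymbols q
  | .branch _ q r => pushedSymbols q ∪ pushedSymbols r
  | .goto _ => ∅
  | .halt => ∅

theorem finite_pushedSymbols [Finite σ] (q : TM2.Stmt Γ Λ σ) : (pushedSymbols q).Finite := by
  induction q with
  | push k f q ih => exact (Set.finite_range _).union ih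
  | peek _ _ _ ih => exact ih
  | pop _ _ _ ih => exact ih
  | load _ _ ih => exact ih
  | branch _ q r ihq ihr => exact ihq.union ihr
  | goto _ => exact Set.finite_empty
  | halt => exact Set.finite_empty

/-- A bound for the number of elementary operations in a statement; a `peek` is a `pop` followed
by a `push`. -/
def stmtSize : TM2.Stmt Γ Λ σ → ℕ
  | .push _ _ q => 1 + stmtSize q
  | .peek _ _ q => 1 + (1 + stmtSize q)
  | .pop _ _ q => 1 + stmtSize q
  | .load _ q => stmtSize q
  | .branch _ q r => stmtSize q + stmtSize r
  | .goto _ => 1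
  | .halt => 0

end Statements

section Simulation

variable {K : Type} {Γ : K → Type} {Λ σ : Type} {U : Set (Σ k, Γ k)}

/-- The alphabets of a program that simulates a machine whose stacks only ever hold symbols from
`U`. The extra stack `none` holds the current label and internal state of the machine. -/
abbrev SimAlphabet (Λ σ : Type) (U : Set (Σ k, Γ k)) : Option K → Type
  | none => Λ × σ
  | some k => {a : Γ k // ⟨k, a⟩ ∈ U}

/-- The store of the simulating program, given its control stack and the simulated stacks. -/
def simStore (ctl : List (Λ × σ)) (T : ∀ k, List {a : Γ k // ⟨k, a⟩ ∈ U}) :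
    Store (SimAlphabet Λ σ U)
  | none => ctl
  | some k => T k

/-- The stacks of the simulated machine. -/
def simStacks (T : ∀ k, List {a : Γ k // ⟨k, a⟩ ∈ U}) (k : K) : List (Γ k) :=
  (T k).map Subtype.val

/-- The program for a statement of the simulated machine in the internal state `v`. -/
def stmtCmd : (q : TM2.Stmt Γ Λ σ) → pushedSymbols q ⊆ U → σ → Cmd (SimAlphabet Λ σ U)
  | .push k f q, h, v =>
    .seq (.push (some k) ⟨f v, h (.inl ⟨v, rfl⟩)⟩) (stmtCmd q (fun _ hs => h (.inr hs)) v)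
  | .peek k f q, h, v =>
    .pop (some k) (stmtCmd q h (f v none))
      fun a => .seq (.push (some k) a) (stmtCmd q h (f v (some a.1)))
  | .pop k f q, h, v =>
    .pop (some k) (stmtCmd q h (f v none)) fun a => stmtCmd q h (f v (some a.1))
  | .load a q, h, v => stmtCmd q h (a v)
  | .branch f q r, h, v =>
    cond (f v) (stmtCmd q (fun _ hs => h (.inl hs)) v) (stmtCmd r (fun _ hs => h (.inr hs)) v)
  | .goto f, _, v => .push none (f v, v)
  | .halt, _, _ => .skip

/-- The control stack for a configuration. -/
def ctlStack (C : TM2.Cfg Γ Λ σ) : List (Λ × σ) := C.l.elim [] fun l => [(l, C.var)]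

variable [DecidableEq K]

theorem update_simStore_none (ctl l : List (Λ × σ)) (T : ∀ k, List {a : Γ k // ⟨k, a⟩ ∈ U}) :
    Function.update (simStore ctl T) none l = simStore l T := by
  funext k
  cases k <;> rfl

theorem update_simStore_some (ctl : List (Λ × σ)) (T : ∀ k, List {a : Γ k // ⟨k, a⟩ ∈ U}) (k : K)
    (l : List {a : Γ k // ⟨k, a⟩ ∈ U}) :
    Function.update (simStore ctl T) (some k) l = simStore ctl (Function.update T k l) := by
  funext j
  cases j with
  | none => rfl
  | some j =>
    by_cases hj : j = k
    · subst hj; simp [simStore]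
    · simp [simStore, hj]

theorem simStacks_update (T : ∀ k, List {a : Γ k // ⟨k, a⟩ ∈ U}) (k : K)
    (l : List {a : Γ k // ⟨k, a⟩ ∈ U}) :
    simStacks (Function.update T k l) = Function.update (simStacks T) k (l.map Subtype.val) := by
  funext j
  by_cases hj : j = k
  · subst hj; simp [simStacks]
  · simp [simStacks, hj]

theorem simStore_nil_single (k : K) (l : List {a : Γ k // ⟨k, a⟩ ∈ U}) :
    simStore [] (Store.single (Γ := fun k => {a : Γ k // ⟨k, a⟩ ∈ U}) k l) =
      (.single (some k) l : Store (SimAlphabet Λ σ U)) := by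
  rw [Store.single, ← update_simStore_some]
  congr 1
  funext j
  cases j <;> rfl

theorem simStacks_single (k : K) (l : List {a : Γ k // ⟨k, a⟩ ∈ U}) :
    simStacks (Store.single k l) = Store.single k (l.map Subtype.val) :=
  simStacks_update _ k l

theorem eq_single_of_simStacks_eq {T : ∀ k, List {a : Γ k // ⟨k, a⟩ ∈ U}} {k : K} {l : List (Γ k)}
    (h : simStacks T = Store.single k l) :
    T = Store.single k (T k) ∧ (T k).map Subtype.val = l := by
  refine ⟨funext fun j => ?_, by simpa [simStacks, Store.single] using congrFun h k⟩
  by_cases hj : j = k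
  · subst hj; simp [Store.single]
  · simpa only [simStacks, Store.single, Function.update_of_ne hj, List.map_eq_nil_iff]
      using congrFun h j

/-- The program `stmtCmd q hq` performs the statement `q` on the simulated stacks and leaves the
control stack of the resulting configuration. -/
def SimulatesStmt (q : TM2.Stmt Γ Λ σ) (hq : pushedSymbols q ⊆ U) : Prop :=
  ∀ v (T : ∀ k, List {a : Γ k // ⟨k, a⟩ ∈ U}),
    ∃ T', simStacks T' = (TM2.stepAux q v (simStacks T)).stk ∧
      RunsWithin (stmtCmd q hq v) (simStore [] T) (stmtSize q)
        (simStore (ctlStack (TM2.stepAux q v (simStacks T))) T')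

theorem SimulatesStmt.peek {q : TM2.Stmt Γ Λ σ} {hq : pushedSymbols q ⊆ U}
    (ih : SimulatesStmt q hq) (k : K) (f : σ → Option (Γ k) → σ) :
    SimulatesStmt (.peek k f q) hq := by
  intro v T
  cases hk : T k with
  | nil =>
    have hS : simStacks T k = [] := by simp [simStacks, hk]
    obtain ⟨T', hT', h⟩ := ih (f v none) T
    simp only [TM2.stepAux, hS, List.head?_nil]
    exact ⟨T', hT', (RunsWithin.pop_nil (S := simStore [] T) (k := some k) hk h).mono
      (Nat.add_le_add_left (Nat.le_add_left _ _) _)⟩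
  | cons a r =>
    have hS : simStacks T k = a.1 :: r.map Subtype.val := by simp [simStacks, hk]
    obtain ⟨T', hT', h⟩ := ih (f v (some a)) T
    simp only [TM2.stepAux, hS, List.head?_cons]
    refine ⟨T', hT', ?_⟩
    refine .pop_cons (S := simStore [] T) (k := some k) hk
      (.seq (.push (Function.update (simStore [] T) (some k) r) (some k) a) ?_)
    have hT : simStore (Λ := Λ) (σ := σ) [] T (some k) = a :: r := hk
    rwa [Function.update_self, Function.update_idem, ← hT, Function.update_eq_self]

theorem SimulatesStmt.pop {q : TM2.Stmt Γ Λ σ} {hq : pushedSymbols q ⊆ U}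
    (ih : SimulatesStmt q hq) (k : K) (f : σ → Option (Γ k) → σ) :
    SimulatesStmt (.pop k f q) hq := by
  intro v T
  cases hk : T k with
  | nil =>
    have hS : simStacks T k = [] := by simp [simStacks, hk]
    have hS' : Function.update (simStacks T) k [] = simStacks T := by
      rw [← hS, Function.update_eq_self]
    obtain ⟨T', hT', h⟩ := ih (f v none) T
    simp only [TM2.stepAux, hS, List.head?_nil, List.tail_nil, hS']
    exact ⟨T', hT', .pop_nil (S := simStore [] T) (k := some k) hk h⟩
  | cons a r =>
    have hS : simStacks T k = a.1 :: r.map Subtype.val := by simp [simStacks, hk]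
    obtain ⟨T', hT', h⟩ := ih (f v (some a)) (Function.update T k r)
    rw [simStacks_update] at hT' h
    simp only [TM2.stepAux, hS, List.head?_cons, List.tail_cons]
    exact ⟨T', hT', .pop_cons (S := simStore [] T) (k := some k) hk
      (update_simStore_some _ T k _ ▸ h)⟩

theorem simulatesStmt (q : TM2.Stmt Γ Λ σ) (hq : pushedSymbols q ⊆ U) : SimulatesStmt q hq := by
  induction q with
  | push k f q ih =>
    intro v T
    obtain ⟨T', hT', h⟩ := ih _ v (Function.update T k (⟨f v, hq (.inl ⟨v, rfl⟩)⟩ :: T k))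
    rw [simStacks_update] at hT' h
    exact ⟨T', hT', (RunsWithin.push _ _ _).seq (update_simStore_some _ T k _ ▸ h)⟩
  | peek k f q ih => exact (ih hq).peek k f
  | pop k f q ih => exact (ih hq).pop k f
  | load a q ih => exact fun v T => ih hq (a v) T
  | branch f q r ihq ihr =>
    intro v T
    cases hf : f v with
    | true =>
      obtain ⟨T', hT', h⟩ := ihq (fun _ hs => hq (.inl hs)) v T
      simp only [TM2.stepAux, stmtCmd, hf, cond_true]
      exact ⟨T', hT', h.mono (Nat.le_add_right _ _)⟩
    | false =>
      obtain ⟨T', hT', h⟩ := ihr (fun _ hs => hq (.inr hs)) v T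
      simp only [TM2.stepAux, stmtCmd, hf, cond_false]
      exact ⟨T', hT', h.mono (Nat.le_add_left _ _)⟩
  | goto f =>
    exact fun v T =>
      ⟨T, rfl, update_simStore_none [] [(f v, v)] T ▸ .push (simStore [] T) none (f v, v)⟩
  | halt => exact fun _ T => ⟨T, rfl, .skip _⟩

/-- The main loop of the simulation; the control stack is empty once the machine has halted. -/
def simLoop (m : Λ → TM2.Stmt Γ Λ σ) (hm : ∀ l, pushedSymbols (m l) ⊆ U) :
    Cmd (SimAlphabet Λ σ U) :=
  .loop none fun p => stmtCmd (m p.1) (hm p.1) p.2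

theorem exists_runsWithin_simLoop [Finite Λ] (m : Λ → TM2.Stmt Γ Λ σ)
    (hm : ∀ l, pushedSymbols (m l) ⊆ U) :
    ∃ c : ℕ, ∀ n C v S' (T : ∀ k, List {a : Γ k // ⟨k, a⟩ ∈ U}), simStacks T = C.stk →
      (flip bind (TM2.step m))^[n] (some C) = some ⟨none, v, S'⟩ →
      ∃ T', simStacks T' = S' ∧
        RunsWithin (simLoop m hm) (simStore (ctlStack C) T) (c * n + 1) (simStore [] T') := by
  obtain ⟨b, hb⟩ := (Set.finite_range fun l => stmtSize (m l)).bddAbove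
  refine ⟨b + 1, fun n => ?_⟩
  induction n with
  | zero =>
    intro C v S' T hT h
    obtain rfl : C = ⟨none, v, S'⟩ := Option.some.inj h
    exact ⟨T, hT, .loop_nil rfl⟩
  | succ n ih =>
    rintro ⟨_ | l, w, S⟩ v S' T hT h
    · have hnone : (flip bind (TM2.step m))^[n] none = none := Function.iterate_fixed rfl n
      exact absurd (hnone.symm.trans h) (by simp)
    · obtain rfl : simStacks T = S := hT
      obtain ⟨T₁, hT₁, h₁⟩ := simulatesStmt (m l) (hm l) w T
      obtain ⟨T', hT', h'⟩ := ih (TM2.stepAux (m l) w (simStacks T)) v S' T₁ hT₁ h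
      have hl : stmtSize (m l) ≤ b := hb ⟨l, rfl⟩
      refine ⟨T', hT', (RunsWithin.loop_cons (a := (l, w)) (r := []) rfl ?_ h').mono
        (t := 1 + (stmtSize (m l) + _)) (by linarith)⟩
      rw [update_simStore_none]
      exact h₁

end Simulation

section FinTM2

variable (tm : FinTM2)

/-- The symbols that can occur on the stacks of a machine during its computations. In contrast to
the alphabets of the machine, this set is always finite. -/
def usedSymbols : Set (Σ k, tm.Γ k) :=
  Set.range (fun a : tm.Γ tm.k₀ => ⟨tm.k₀, a⟩) ∪ ⋃ l, pushedSymbols (tm.m l)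

theorem finite_usedSymbols : (usedSymbols tm).Finite := by
  have := tm.Γk₀Fin
  have := tm.ΛFin
  have := tm.σFin
  exact (Set.finite_range _).union (Set.finite_iUnion fun l => finite_pushedSymbols _)

/-- The alphabets of the program that simulates the machine `tm`. -/
abbrev MachineAlphabet : Option tm.K → Type := SimAlphabet tm.Λ tm.σ (usedSymbols tm)

instance finite_machineAlphabet : ∀ k, Finite (MachineAlphabet tm k)
  | none =>
    have := tm.ΛFin
    have := tm.σFin
    inferInstanceAs (Finite (tm.Λ × tm.σ))
  | some _ => ((finite_usedSymbols tm).preimage (f := Sigma.mk _)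
      sigma_mk_injective.injOn).to_subtype

variable {tm}

/-- An input symbol, as a symbol of the simulating program. -/
def inputSymbol (a : tm.Γ tm.k₀) : MachineAlphabet tm (some tm.k₀) := ⟨a, .inl ⟨a, rfl⟩⟩

variable (tm)

/-- The program that simulates the machine `tm`. -/
def machineCmd : Cmd (MachineAlphabet tm) :=
  .seq (.push none (tm.main, tm.initialState))
    (simLoop tm.m fun l _ hs => .inr (Set.mem_iUnion.2 ⟨l, hs⟩))

theorem exists_runsWithin_machineCmd :
    ∃ c : ℕ, ∀ x y t, TM2OutputsInTime tm x (some y) t → ∃ y', y'.map Subtype.val = y ∧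
      RunsWithin (machineCmd tm) (.single (some tm.k₀) (x.map inputSymbol)) (c * t + 2)
        (.single (some tm.k₁) y') := by
  have := tm.ΛFin
  obtain ⟨c, hc⟩ := exists_runsWithin_simLoop (U := usedSymbols tm) tm.m
    fun l _ hs => .inr (Set.mem_iUnion.2 ⟨l, hs⟩)
  refine ⟨c, fun x y t h => ?_⟩
  have hsteps : (flip bind (TM2.step tm.m))^[h.steps]
      (some ⟨some tm.main, tm.initialState, Store.single tm.k₀ x⟩) =
        some ⟨none, tm.initialState, Store.single tm.k₁ y⟩ :=
    initList_eq tm x ▸ haltList_eq tm y ▸ h.evals_in_steps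
  obtain ⟨T', hT', hr⟩ := hc h.steps _ _ _ (Store.single tm.k₀ (x.map inputSymbol))
    (by simp [simStacks_single, inputSymbol, Function.comp_def]) hsteps
  obtain ⟨hT', hy⟩ := eq_single_of_simStacks_eq hT'
  rw [hT', simStore_nil_single] at hr
  refine ⟨T' tm.k₁, hy, ((RunsWithin.push _ none _).seq (u := c * h.steps + 1) ?_).mono ?_⟩
  · rw [← simStore_nil_single, update_simStore_none]
    exact hr
  · have := Nat.mul_le_mul_left c h.steps_le_m
    omega

end FinTM2

/-! ### Printing -/

instance : Finite Symbol :=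
  Finite.of_surjective (Sum.elim encBit fun b => cond b .lpar .rpar) fun
    | .zero => ⟨.inl false, rfl⟩
    | .one => ⟨.inl true, rfl⟩
    | .lpar => ⟨.inr true, rfl⟩
    | .rpar => ⟨.inr false, rfl⟩

/-- The stacks of the printing programs: the input, the output (which is printed from right to
left), a copy of the input, and two counters. -/
inductive PrintReg
  | inp
  | out
  | tmp
  | acc
  | aux
  deriving DecidableEq

instance : Fintype PrintReg :=
  ⟨{.inp, .out, .tmp, .acc, .aux}, fun r => by cases r <;> decide⟩

/-- The alphabets of the printing programs. -/
abbrev PrintAlphabet : PrintReg → Type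
  | .inp => Bool
  | .out => Symbol
  | .tmp => Bool
  | .acc => Unit
  | .aux => Unit

instance finite_printAlphabet : ∀ k, Finite (PrintAlphabet k)
  | .inp => inferInstanceAs (Finite Bool)
  | .out => inferInstanceAs (Finite Symbol)
  | .tmp => inferInstanceAs (Finite Bool)
  | .acc => inferInstanceAs (Finite Unit)
  | .aux => inferInstanceAs (Finite Unit)

/-- The contents of the stacks of a printing program. -/
structure PrintRegs where
  inp : List Bool := []
  out : List Symbol := []
  tmp : List Bool := []
  acc : ℕ := 0
  aux : ℕ := 0

/-- The store of a printing program; the counters are in unary. -/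
def PrintRegs.store (R : PrintRegs) : Store PrintAlphabet
  | .inp => R.inp
  | .out => R.out
  | .tmp => R.tmp
  | .acc => List.replicate R.acc ()
  | .aux => List.replicate R.aux ()

namespace PrintRegs

variable (R : PrintRegs)

theorem update_inp (l : List Bool) :
    Function.update R.store .inp l = { R with inp := l }.store := by
  funext k; cases k <;> rfl

theorem update_out (l : List Symbol) :
    Function.update R.store .out l = { R with out := l }.store := by
  funext k; cases k <;> rfl

theorem update_tmp (l : List Bool) :
    Function.update R.store .tmp l = { R with tmp := l }.store := by
  funext k; cases k <;> rfl

theorem update_acc (l : List Unit) :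
    Function.update R.store .acc l = { R with acc := l.length }.store := by
  funext k; cases k <;> first | rfl | exact List.eq_replicate_of_mem fun _ _ => rfl

theorem update_aux (l : List Unit) :
    Function.update R.store .aux l = { R with aux := l.length }.store := by
  funext k; cases k <;> first | rfl | exact List.eq_replicate_of_mem fun _ _ => rfl

theorem runsWithin_push_inp (b : Bool) :
    RunsWithin (.push .inp b) R.store 1 { R with inp := b :: R.inp }.store :=
  (RunsWithin.push R.store .inp b).congr rfl (update_inp R _) le_rfl

theorem runsWithin_push_out (s : Symbol) :
    RunsWithin (.push .out s) R.store 1 { R with out := s :: R.out }.store :=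
  (RunsWithin.push R.store .out s).congr rfl (update_out R _) le_rfl

theorem runsWithin_push_tmp (b : Bool) :
    RunsWithin (.push .tmp b) R.store 1 { R with tmp := b :: R.tmp }.store :=
  (RunsWithin.push R.store .tmp b).congr rfl (update_tmp R _) le_rfl

theorem runsWithin_push_acc :
    RunsWithin (.push .acc ()) R.store 1 { R with acc := R.acc + 1 }.store :=
  (RunsWithin.push R.store .acc ()).congr rfl ((update_acc R _).trans (by simp [store])) le_rfl

theorem runsWithin_push_aux :
    RunsWithin (.push .aux ()) R.store 1 { R with aux := R.aux + 1 }.store :=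
  (RunsWithin.push R.store .aux ()).congr rfl ((update_aux R _).trans (by simp [store])) le_rfl

theorem runsWithin_pushAll_out (l : List Symbol) :
    RunsWithin (.pushAll .out l) R.store l.length { R with out := l ++ R.out }.store :=
  (runsWithin_pushAll .out l R.store).congr rfl (update_out R _) le_rfl

theorem runsWithin_pushAll_acc (n : ℕ) :
    RunsWithin (.pushAll .acc (List.replicate n ())) R.store n { R with acc := n + R.acc }.store :=
  (runsWithin_pushAll .acc (List.replicate n ()) R.store).congr rfl
    ((update_acc R _).trans (by simp [store])) (by simp)

end PrintRegs

/-- Run `f` on each bit of the input, from the last to the first, and preserve the input. -/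
def scanCmd (f : Bool → Cmd PrintAlphabet) : Cmd PrintAlphabet :=
  .seq (.loop .inp fun b => .push .tmp b) (.loop .tmp fun b => .seq (.push .inp b) (f b))

theorem runsWithin_scanCmd {σ : Type} {f : Bool → Cmd PrintAlphabet} {n : ℕ} (J : σ → PrintRegs)
    (g : Bool → σ → σ) (hf : ∀ b l t s, RunsWithin (f b) { J s with inp := l, tmp := t }.store n
      { J (g b s) with inp := l, tmp := t }.store) (x : List Bool) (s : σ) :
    RunsWithin (scanCmd f) { J s with inp := x, tmp := [] }.store ((n + 4) * x.length + 2)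
      { J (x.foldr g s) with inp := x, tmp := [] }.store := by
  have hfold : x.reverse.foldl (fun q b => (b :: q.1, g b q.2)) ([], s) = (x, x.foldr g s) := by
    rw [List.foldl_reverse]
    induction x with
    | nil => rfl
    | cons b x ih => rw [List.foldr_cons, ih, List.foldr_cons]
  have hload := RunsWithin.loop (k := .inp) (fun l t => { J s with inp := l, tmp := t }.store)
    (fun t b => b :: t) (fun _ _ _ => PrintRegs.update_inp _ _)
    (fun b _ _ => PrintRegs.runsWithin_push_tmp _ b) x []
  have hscan := RunsWithin.loop (k := .tmp) (σ := List Bool × σ)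
    (fun l q => { J q.2 with inp := q.1, tmp := l }.store) (fun q b => (b :: q.1, g b q.2))
    (fun _ _ _ => PrintRegs.update_tmp _ _)
    (fun b l q => (PrintRegs.runsWithin_push_inp { J q.2 with inp := q.1, tmp := l } b).seq
      (hf b _ _ _)) x.reverse ([], s)
  rw [List.foldl_flip_cons_eq_append, List.map_id', List.append_nil] at hload
  rw [hfold, List.length_reverse] at hscan
  exact (hload.seq hscan).mono (by linarith)

/-- Multiply the counter `acc` by the length of the input. -/
def mulCmd : Cmd PrintAlphabet :=
  .seq (.loop .acc fun _ => scanCmd fun _ => .push .aux ()) (.loop .aux fun _ => .push .acc ())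

theorem runsWithin_mulCmd (x : List Bool) (o : List Symbol) (a : ℕ) :
    RunsWithin mulCmd { inp := x, out := o, acc := a : PrintRegs }.store
      ((5 * x.length + 3) * a + 2 * (a * x.length) + 2)
      { inp := x, out := o, acc := a * x.length : PrintRegs }.store := by
  have hadd (l : List Unit) (b : ℕ) :=
    runsWithin_scanCmd (fun b => { out := o, acc := l.length, aux := b }) (fun _ b => b + 1)
      (fun _ _ _ _ => PrintRegs.runsWithin_push_aux _) x b
  have hmul := RunsWithin.loop (k := .acc)
    (fun (l : List Unit) b => { inp := x, out := o, acc := l.length, aux := b : PrintRegs }.store)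
    (fun b _ => b + x.length) (fun _ _ _ => PrintRegs.update_acc _ _)
    (fun _ l b => by simpa using hadd l b) (List.replicate a ()) 0
  have hmove := RunsWithin.loop (k := .aux)
    (fun (l : List Unit) b => { inp := x, out := o, acc := b, aux := l.length : PrintRegs }.store)
    (fun b _ => b + 1) (fun _ _ _ => PrintRegs.update_aux _ _)
    (fun _ l b => PrintRegs.runsWithin_push_acc _) (List.replicate (a * x.length) ()) 0
  simp only [List.foldl_add_const, List.length_replicate, List.length_nil, zero_add,
    one_mul] at hmul hmove
  rw [mul_comm x.length] at hmul
  exact (hmul.seq hmove).mono (by linarith)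

theorem exists_runsWithin_eval (p : Polynomial ℕ) : ∃ (c : Cmd PrintAlphabet) (T : Polynomial ℕ),
    ∀ x o, RunsWithin c { inp := x, out := o : PrintRegs }.store (T.eval x.length)
      { inp := x, out := o, acc := p.eval x.length : PrintRegs }.store := by
  induction p using Polynomial.recOnHorner with
  | M0 => exact ⟨.skip, 0, fun x o => by simpa using .skip _⟩
  | MC p a _ _ ih =>
    obtain ⟨c, T, h⟩ := ih
    refine ⟨.seq c (.pushAll .acc (List.replicate a ())), T + .C a, fun x o => ?_⟩
    simpa [add_comm] using (h x o).seq (PrintRegs.runsWithin_pushAll_acc _ a)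
  | MX p _ ih =>
    obtain ⟨c, T, h⟩ := ih
    refine ⟨.seq c mulCmd, T + ((5 * .X + 3) * p + 2 * (p * .X) + 2), fun x o => ?_⟩
    simpa using (h x o).seq (runsWithin_mulCmd x o _)

/-- `f x` can be printed in front of any output in polynomial time, without changing the input
`x`. -/
def Printable (f : List Bool → List Symbol) : Prop :=
  ∃ (c : Cmd PrintAlphabet) (T : Polynomial ℕ), ∀ x o,
    RunsWithin c { inp := x, out := o : PrintRegs }.store (T.eval x.length)
      { inp := x, out := f x ++ o : PrintRegs }.store

namespace Printable

theorem const (l : List Symbol) : Printable fun _ => l :=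
  ⟨.pushAll .out l, .C l.length, fun x o => by
    simpa using PrintRegs.runsWithin_pushAll_out { inp := x, out := o } l⟩

theorem append {f g : List Bool → List Symbol} (hf : Printable f) (hg : Printable g) :
    Printable fun x => f x ++ g x := by
  obtain ⟨c, T, hc⟩ := hf
  obtain ⟨d, U, hd⟩ := hg
  refine ⟨.seq d c, U + T, fun x o => ?_⟩
  simpa using (hd x o).seq (hc x (g x ++ o))

theorem parenthesize {f : List Bool → List Symbol} (hf : Printable f) :
    Printable fun x => .lpar :: (f x ++ [.rpar]) :=
  (const [.lpar]).append (hf.append (const [.rpar]))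

theorem encBits : Printable encBits :=
  parenthesize ⟨scanCmd fun b => .push .out (encBit b), 5 * .X + 2, fun x o => by
    have h := runsWithin_scanCmd (fun o => { out := o }) (fun b o => encBit b :: o)
      (fun b _ _ _ => PrintRegs.runsWithin_push_out _ (encBit b)) x o
    simpa [List.foldr_cons_eq_append] using h⟩

theorem encUnary (p : Polynomial ℕ) : Printable fun x => encUnary (p.eval x.length) := by
  obtain ⟨c, T, hc⟩ := exists_runsWithin_eval p
  refine parenthesize (f := fun x => (List.replicate (p.eval x.length) true).map encBit)
    ⟨.seq c (.loop .acc fun _ => .push .out .one), T + (2 * p + 1), fun x o => ?_⟩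
  have hfold (n : ℕ) (o : List Symbol) : (List.replicate n ()).foldl (fun o _ => .one :: o) o =
      (List.replicate n true).map encBit ++ o := by
    induction n generalizing o with
    | zero => rfl
    | succ n ih =>
      rw [List.replicate_succ, List.foldl_cons, ih, List.replicate_succ', List.map_append,
        List.append_assoc]
      rfl
  have hloop := RunsWithin.loop (k := .acc)
    (fun (l : List Unit) o => { inp := x, out := o, acc := l.length : PrintRegs }.store)
    (fun o _ => .one :: o) (fun _ _ _ => PrintRegs.update_acc _ _)
    (fun _ l b => PrintRegs.runsWithin_push_out _ _) (List.replicate (p.eval x.length) ()) o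
  rw [hfold, List.length_replicate] at hloop
  simpa using (hc x o).seq hloop

theorem polyTime {f : List Bool → List Symbol} (hf : Printable f) :
    Nonempty (TM2ComputableInPolyTime (id : List Bool → _) (id : List Symbol → _) f) := by
  obtain ⟨c, T, hc⟩ := hf
  refine polyTime_of_runsWithin (.seq c (.loop .inp fun _ => .skip)) .inp .out (T + (.X + 1)) f
    fun x => ?_
  have hinp : (.single .inp x : Store PrintAlphabet) = { inp := x : PrintRegs }.store := by
    funext k; cases k <;> rfl
  have hout : (.single .out (f x) : Store PrintAlphabet) = { out := f x : PrintRegs }.store := by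
    funext k; cases k <;> rfl
  have hclear := RunsWithin.loop (k := .inp)
    (fun l (_ : Unit) => { inp := l, out := f x : PrintRegs }.store) (fun _ _ => ())
    (fun _ _ _ => PrintRegs.update_inp _ _) (fun _ _ _ => .skip _) x ()
  rw [hinp, hout]
  have hprint := hc x []
  rw [List.append_nil] at hprint
  simpa using hprint.seq hclear

end Printable

/-! ### Unique readability -/

/-- A uniquely readable code: the first of several concatenated code words determines its object
and where it ends. -/
def SelfDelimiting {α : Type} (f : α → List Symbol) : Prop :=
  ∀ a b r s, f a ++ r = f b ++ s → a = b ∧ r = s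

/-- No code word is empty or begins with a closing parenthesis, so that the end of a list of code
words can be recognized. -/
def ProperStart {α : Type} (f : α → List Symbol) : Prop :=
  ∀ a r s, f a ++ r ≠ .rpar :: s

namespace SelfDelimiting

variable {α β : Type} {f : α → List Symbol} {g : β → List Symbol}

theorem append_eq_append_iff (hf : SelfDelimiting f) {a b : α} {r s : List Symbol} :
    f a ++ r = f b ++ s ↔ a = b ∧ r = s :=
  ⟨hf a b r s, fun ⟨hab, hrs⟩ => hab ▸ hrs ▸ rfl⟩

theorem injective (hf : SelfDelimiting f) : Function.Injective f := fun a b h =>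
  (hf a b [] [] (by rw [h])).1

theorem comp (hf : SelfDelimiting f) {e : β → α} (he : Function.Injective e) :
    SelfDelimiting (f ∘ e) := fun _ _ _ _ h =>
  (hf _ _ _ _ h).imp_left (he ·)

theorem prod (hf : SelfDelimiting f) (hg : SelfDelimiting g) :
    SelfDelimiting fun x : α × β => f x.1 ++ g x.2 := by
  rintro ⟨a, b⟩ ⟨a', b'⟩ r s h
  rw [List.append_assoc, List.append_assoc, hf.append_eq_append_iff,
    hg.append_eq_append_iff] at h
  exact ⟨Prod.ext h.1 h.2.1, h.2.2⟩

theorem encList (hf : SelfDelimiting f) (hf' : ProperStart f) : SelfDelimiting (encList f) := by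
  intro a b r s h
  simp only [Evac.encList, List.cons_append, List.cons.injEq, true_and, List.append_assoc,
    List.nil_append] at h
  induction a generalizing b with
  | nil =>
    cases b with
    | nil => simpa using h
    | cons y b =>
      rw [List.flatMap_cons, List.append_assoc] at h
      exact absurd h.symm (hf' y _ _)
  | cons x a ih =>
    cases b with
    | nil =>
      rw [List.flatMap_cons, List.append_assoc] at h
      exact absurd h (hf' x _ _)
    | cons y b =>
      rw [List.flatMap_cons, List.flatMap_cons, List.append_assoc, List.append_assoc,
        hf.append_eq_append_iff] at h
      exact (ih b h.2).imp_left fun hab => congrArg₂ _ h.1 hab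

end SelfDelimiting

theorem encBit_injective : Function.Injective encBit := by
  rintro (_ | _) (_ | _) h <;> first | rfl | cases h

theorem Symbol.toNat_injective : Function.Injective Symbol.toNat := by
  rintro (_ | _) (_ | _) h <;> first | rfl | cases h

theorem selfDelimiting_singleton_encBit : SelfDelimiting fun b => [encBit b] := fun _ _ _ _ h =>
  (List.cons.inj h).imp_left (encBit_injective ·)

theorem encBits_eq_encList : encBits = encList fun b => [encBit b] := by
  funext l
  rw [encBits, encList, List.map_eq_flatMap]

theorem properStart_singleton_encBit : ProperStart fun b => [encBit b] := by
  rintro (_ | _) r s h <;> cases h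

theorem selfDelimiting_encBits : SelfDelimiting encBits :=
  encBits_eq_encList ▸ selfDelimiting_singleton_encBit.encList properStart_singleton_encBit

theorem properStart_encNat : ProperStart encNat := fun _ _ _ h => nomatch h

theorem properStart_encList {α : Type} (f : α → List Symbol) : ProperStart (encList f) :=
  fun _ _ _ h => nomatch h

theorem bits_injective : Function.Injective Nat.bits := fun m n h =>
  Nat.digits_inj_iff.1 (by rw [Nat.digits_two_eq_bits, Nat.digits_two_eq_bits, h])

theorem selfDelimiting_encNat : SelfDelimiting encNat :=
  selfDelimiting_encBits.comp bits_injective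

theorem selfDelimiting_encUnary : SelfDelimiting encUnary :=
  selfDelimiting_encBits.comp (List.replicate_left_injective true)

theorem selfDelimiting_encInt : SelfDelimiting encInt := by
  rintro (a | a) (b | b) r s h
  · exact (selfDelimiting_encNat _ _ _ _ (List.cons.inj h).2).imp_left (congrArg _)
  · cases h
  · cases h
  · exact (selfDelimiting_encNat _ _ _ _ (List.cons.inj h).2).imp_left (congrArg _)

theorem selfDelimiting_encLoc {n : ℕ} {G : BuildingGraph (Fin n)} :
    SelfDelimiting (encLoc (G := G)) := by
  have hvertex := selfDelimiting_encNat.comp (Fin.val_injective (n := n))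
  have hedge := (hvertex.prod hvertex).comp (Subtype.val_injective (p := (· ∈ G.E)))
  rintro (a | a) (b | b) r s h
  · exact (hvertex _ _ _ _ (List.cons.inj h).2).imp_left (congrArg _)
  · cases h
  · cases h
  · exact (hedge _ _ _ _ (List.cons.inj h).2).imp_left (congrArg _)

theorem properStart_encLoc {n : ℕ} {G : BuildingGraph (Fin n)} :
    ProperStart (encLoc (G := G)) := by
  rintro (_ | _) r s h <;> cases h

theorem selfDelimiting_encInstr : SelfDelimiting encInstr := by
  have hpush := selfDelimiting_encNat.prod (selfDelimiting_encNat.prod selfDelimiting_encNat)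
  have hpop := selfDelimiting_encNat.prod (selfDelimiting_encNat.prod
    (selfDelimiting_encNat.encList properStart_encNat))
  rintro (⟨k, a, b⟩ | ⟨k, a, b⟩) (⟨k', a', b'⟩ | ⟨k', a', b'⟩) r s h
  · obtain ⟨hargs, hrest⟩ := hpush (k, a, b) (k', a', b') _ _ (List.cons.inj h).2
    cases hargs
    exact ⟨rfl, hrest⟩
  · cases h
  · cases h
  · obtain ⟨hargs, hrest⟩ := hpop (k, a, b) (k', a', b') _ _ (List.cons.inj h).2
    cases hargs
    exact ⟨rfl, hrest⟩

theorem properStart_encInstr : ProperStart encInstr := by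
  rintro (_ | _) r s h <;> cases h

theorem BehaviorCode.enc_injective : Function.Injective BehaviorCode.enc := by
  have hcode := (selfDelimiting_encInstr.encList properStart_encInstr).prod
    (selfDelimiting_encBits.prod selfDelimiting_encUnary)
  exact (hcode.comp (e := fun B : BehaviorCode => (B.code, B.data, B.clock))
    fun ⟨_, _, _⟩ ⟨_, _, _⟩ h => by cases h; rfl).injective

theorem encState_append_inj {n m m' : ℕ} {G : BuildingGraph (Fin n)} {s : State G (Fin m)}
    {s' : State G (Fin m')} {r r' : List Symbol} (h : encState s ++ r = encState s' ++ r') :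
    (⟨m, s⟩ : Σ m, Fin m → G.Loc) = ⟨m', s'⟩ ∧ r = r' :=
  (selfDelimiting_encLoc.encList properStart_encLoc _ _ _ _ h).imp_left List.ofFn_inj'.1

theorem selfDelimiting_encState {n m : ℕ} {G : BuildingGraph (Fin n)} :
    SelfDelimiting (encState (m := m) (G := G)) :=
  (selfDelimiting_encLoc.encList properStart_encLoc).comp List.ofFn_injective

theorem selfDelimiting_encSchedule {n m tmax : ℕ} {G : BuildingGraph (Fin n)} :
    SelfDelimiting (encSchedule (m := m) (tmax := tmax) (G := G)) :=
  (selfDelimiting_encState.encList fun _ _ _ h => nomatch h).comp List.ofFn_injective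

theorem BehaviorCode.Describes.unique {B : BehaviorCode} {n m tmax : ℕ}
    {G : BuildingGraph (Fin n)} {s₀ : State G (Fin m)} {β β' : BehaviorModel G s₀ tmax}
    (h : B.Describes β) (h' : B.Describes β') : β = β' := by
  funext es
  obtain ⟨l, ho, hl⟩ := h es
  obtain ⟨l', ho', hl'⟩ := h' es
  have hentry : SelfDelimiting fun x : ℚ≥0 × WES G s₀ tmax =>
      encNat x.1.num ++ (encNat x.1.den ++ encSchedule x.2.1) := by
    refine (selfDelimiting_encNat.prod (selfDelimiting_encNat.prod selfDelimiting_encSchedule)).comp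
      (e := fun x : ℚ≥0 × WES G s₀ tmax => (x.1.num, x.1.den, x.2.1)) fun x y hxy => ?_
    simp only [Prod.mk.injEq] at hxy
    exact Prod.ext (NNRat.ext_num_den hxy.1 hxy.2.1) (Subtype.ext hxy.2.2)
  obtain rfl : l = l' := (hentry.encList fun _ _ _ h => nomatch h).injective
    (Symbol.toNat_injective.list_map (ho.2.symm.trans ho'.2))
  exact Subtype.ext (funext fun w => (hl w).trans (hl' w).symm)

/-- What the code of a graph records about a vertex: whether it is an exit, and its capacity. -/
def vertexData {n : ℕ} (G : BuildingGraph (Fin n)) (v : Fin n) : Bool × ℤ :=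
  (decide (v ∈ G.EX), G.c (.inl v))

/-- The entries of the adjacency matrix, as written in the code of a graph. -/
def edgeData {n : ℕ} (G : BuildingGraph (Fin n)) (u v : Fin n) : Option (ℤ × ℤ) :=
  if h : (u, v) ∈ G.E then some (G.c (.inr ⟨(u, v), h⟩), G.d (.inr ⟨(u, v), h⟩)) else none

/-- The code of an entry of the list of vertices. -/
def encVertexData (x : Bool × ℤ) : List Symbol := [encBit x.1] ++ encInt x.2

/-- The code of an entry of the adjacency matrix. -/
def encEdgeData : Option (ℤ × ℤ) → List Symbol
  | some x => .one :: (encInt x.1 ++ encInt x.2)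
  | none => [.zero]

theorem selfDelimiting_encVertexData : SelfDelimiting encVertexData :=
  selfDelimiting_singleton_encBit.prod selfDelimiting_encInt

theorem properStart_encVertexData : ProperStart encVertexData := by
  rintro ⟨_ | _, _⟩ r s h <;> cases h

theorem selfDelimiting_encEdgeData : SelfDelimiting encEdgeData := by
  have hsome := selfDelimiting_encInt.prod selfDelimiting_encInt
  rintro (_ | a) (_ | b) r s h
  · exact ⟨rfl, (List.cons.inj h).2⟩
  · cases h
  · cases h
  · exact (hsome _ _ _ _ (List.cons.inj h).2).imp_left (congrArg _)

theorem properStart_encEdgeData : ProperStart encEdgeData := by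
  rintro (_ | _) r s h <;> cases h

theorem encGraph_eq {n : ℕ} (G : BuildingGraph (Fin n)) :
    encGraph G = encList encVertexData (List.ofFn (vertexData G)) ++
      encList (encList encEdgeData) (List.ofFn fun u => List.ofFn (edgeData G u)) := by
  have hedge (u v : Fin n) : encEdgeData (edgeData G u v) = if h : (u, v) ∈ G.E then
      .one :: (encInt (G.c (.inr ⟨(u, v), h⟩)) ++ encInt (G.d (.inr ⟨(u, v), h⟩)))
      else [.zero] := by
    unfold edgeData
    split <;> rfl
  simp only [encGraph, encList, List.ofFn_eq_map, List.flatMap_map, hedge]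
  rfl

theorem eq_of_vertexData_eq_of_edgeData_eq {n : ℕ} {G G' : BuildingGraph (Fin n)}
    (hv : vertexData G = vertexData G') (he : edgeData G = edgeData G') : G = G' := by
  obtain ⟨E, EX, hEX, c, d, hd⟩ := G
  obtain ⟨E', EX', hEX', c', d', hd'⟩ := G'
  obtain rfl : E = E' := by
    ext ⟨u, v⟩
    have := congrArg Option.isSome (congrFun₂ he u v)
    by_cases h : (u, v) ∈ E <;> by_cases h' : (u, v) ∈ E' <;> simp_all [edgeData]
  obtain rfl : EX = EX' := by
    ext v
    simpa [vertexData] using congrArg Prod.fst (congrFun hv v)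
  have hcd (e) : c (.inr e) = c' (.inr e) ∧ d (.inr e) = d' (.inr e) := by
    obtain ⟨⟨u, v⟩, h⟩ := e
    simpa [edgeData, h] using congrFun₂ he u v
  obtain rfl : c = c' := by
    funext x
    exact x.casesOn (fun v => congrArg Prod.snd (congrFun hv v)) fun e => (hcd e).1
  obtain rfl : d = d' := by
    funext x
    exact x.casesOn (fun v => (hd v).trans (hd' v).symm) fun e => (hcd e).2
  rfl

theorem encGraph_append_inj {n n' : ℕ} {G : BuildingGraph (Fin n)} {G' : BuildingGraph (Fin n')}
    {r r' : List Symbol} (h : encGraph G ++ r = encGraph G' ++ r') :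
    (⟨n, G⟩ : Σ n, BuildingGraph (Fin n)) = ⟨n', G'⟩ ∧ r = r' := by
  rw [encGraph_eq, encGraph_eq, List.append_assoc, List.append_assoc,
    (selfDelimiting_encVertexData.encList properStart_encVertexData).append_eq_append_iff,
    ((selfDelimiting_encEdgeData.encList properStart_encEdgeData).encList
      (properStart_encList _)).append_eq_append_iff] at h
  obtain ⟨hv, he, hr⟩ := h
  obtain rfl : n = n' := by simpa using congrArg List.length hv
  have hG : G = G' := eq_of_vertexData_eq_of_edgeData_eq (List.ofFn_injective hv)
    (funext fun u => List.ofFn_injective (congrFun (List.ofFn_injective he) u))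
  exact ⟨hG ▸ rfl, hr⟩

theorem Instance.eq_of_enc_eq {I I' : Instance} {B B' : BehaviorCode} (hB : B.Describes I.β)
    (hB' : B'.Describes I'.β) (h : I.enc B = I'.enc B') : I = I' := by
  obtain ⟨n, m, tmax, G, hc, s₀, β, D, K, hK⟩ := I
  obtain ⟨n', m', tmax', G', hc', s₀', β', D', K', hK'⟩ := I'
  simp only [Instance.enc] at h
  obtain ⟨hG, hafterG⟩ := encGraph_append_inj h
  obtain ⟨rfl, hG⟩ := Sigma.mk.inj_iff.1 hG
  obtain rfl := eq_of_heq hG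
  obtain ⟨hs, hafters⟩ := encState_append_inj hafterG
  obtain ⟨rfl, hs⟩ := Sigma.mk.inj_iff.1 hs
  obtain rfl := eq_of_heq hs
  rw [selfDelimiting_encUnary.append_eq_append_iff, selfDelimiting_encNat.append_eq_append_iff,
    selfDelimiting_encNat.append_eq_append_iff] at hafters
  obtain ⟨rfl, hD, rfl, hcode⟩ := hafters
  obtain rfl := BehaviorCode.enc_injective hcode
  obtain rfl := Fin.ext hD
  obtain rfl := hB.unique hB'
  rfl

/-! ### Buildings in which schedules are bit strings -/

/-- The building of the reduction: two rooms `0` and `1` and an exit `2`, every two of them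
connected. No edge has any capacity, so that under a strong schedule people visit vertices only. -/
def certGraph : BuildingGraph (Fin 3) where
  E := Finset.univ
  EX := {2}
  EX_ssubset := by decide
  c := Sum.elim (fun _ => 1) fun _ => 0
  d := fun _ => 0
  d_vertex _ := rfl

/-- The schedule in which a single person is at the vertex `pos t` at time `t`. -/
def vertexSchedule {tmax : ℕ} (pos : Fin (tmax + 1) → Fin 3) :
    Schedule certGraph (Fin 1) tmax := fun t _ => Sum.inl (pos t)

/-- The vertices visited by the only person; the value `2` on edges is arbitrary. -/
def positions {tmax : ℕ} (es : Schedule certGraph (Fin 1) tmax) (t : Fin (tmax + 1)) : Fin 3 :=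
  Sum.elim id (fun _ => 2) (es t 0)

/-- Whoever follows these positions never leaves the exit. -/
def StaysAtExit {M : ℕ} (pos : Fin M → Fin 3) : Prop :=
  ∀ t t', t < t' → pos t = 2 → pos t' = 2

theorem StaysAtExit.cons_zero {M : ℕ} {pos : Fin M → Fin 3} (h : StaysAtExit pos) :
    StaysAtExit (Fin.cons 0 pos : Fin (M + 1) → Fin 3) := by
  intro t t' htt' ht
  cases t using Fin.cases with
  | zero => cases ht
  | succ i =>
    cases t' using Fin.cases with
    | zero => exact absurd htt' (Fin.not_lt_zero _)
    | succ j => exact h i j (Fin.succ_lt_succ_iff.1 htt') ht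

theorem isWES_vertexSchedule {tmax : ℕ} {pos : Fin (tmax + 1) → Fin 3} (h : StaysAtExit pos) :
    IsWES (vertexSchedule pos) where
  from_vertex _ t t' _ v hv := by
    obtain rfl : pos t = v := Sum.inl_injective hv
    exact .inr (.inr ⟨⟨(pos t, pos t'), Finset.mem_univ _⟩, rfl, rfl⟩)
  from_edge _ _ _ _ _ he := nomatch he
  travel_time _ _ _ _ htt' _ _ := sub_nonneg.2 (Int.ofNat_le.2 htt')
  exit_absorbing _ t t' htt' v hv hpos := by
    obtain rfl : pos t = v := Sum.inl_injective hpos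
    have ht : pos t = 2 := Finset.mem_singleton.1 hv
    exact congrArg Sum.inl ((h t t' htt' ht).trans ht.symm)

theorem isSES_vertexSchedule {tmax : ℕ} {pos : Fin (tmax + 1) → Fin 3}
    (h : StaysAtExit pos) (hlast : pos (Fin.last tmax) = 2) :
    IsSES (vertexSchedule pos) where
  toIsWES := isWES_vertexSchedule h
  vertex_capacity _ _ := Int.ofNat_le.2 ((Finset.card_le_univ _).trans_eq (Fintype.card_fin 1))
  edge_capacity _ _ := by
    simp only [vertexSchedule, reduceCtorEq, Finset.filter_false, Finset.card_empty]
    exact le_rfl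
  all_evacuated _ := ⟨2, Finset.mem_singleton_self _, congrArg Sum.inl hlast⟩

section StrongSchedule

variable {tmax : ℕ} {es : Schedule certGraph (Fin 1) tmax}

theorem IsSES.ne_edge (h : IsSES es) (t : Fin (tmax + 1)) (e : {e // e ∈ certGraph.E}) :
    es t 0 ≠ Sum.inr e := fun he =>
  (h.edge_capacity t e).not_gt (Nat.cast_pos.2 (Finset.card_pos.2 ⟨0, by simpa using he⟩))

theorem IsSES.eq_vertexSchedule (h : IsSES es) : es = vertexSchedule (positions es) := by
  funext t p
  rw [Subsingleton.elim p 0]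
  rcases ht : es t 0 with v | e
  · simp [vertexSchedule, positions, ht]
  · exact absurd ht (h.ne_edge t e)

theorem IsSES.positions_last (h : IsSES es) : positions es (Fin.last tmax) = 2 := by
  obtain ⟨v, hv, hlast⟩ := h.all_evacuated 0
  rw [positions, hlast]
  exact Finset.mem_singleton.1 hv

end StrongSchedule

/-- The string spelled by a visit to a vertex: each room stands for a bit. -/
def vertexBits : Fin 3 → List Bool
  | 0 => [false]
  | 1 => [true]
  | 2 => []

/-- The string spelled by a sequence of vertices. -/
def spell (l : List (Fin 3)) : List Bool := l.flatMap vertexBits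

/-- The certificate spelled by the vertices visited after time `0`. -/
def certificate {N : ℕ} (pos : Fin (N + 2) → Fin 3) : List Bool :=
  spell (List.ofFn fun i : Fin (N + 1) => pos i.succ)

theorem length_vertexBits_le (v : Fin 3) : (vertexBits v).length ≤ 1 := by
  fin_cases v <;> simp [vertexBits]

theorem reverse_vertexBits (v : Fin 3) : (vertexBits v).reverse = vertexBits v := by
  fin_cases v <;> rfl

theorem length_spell_le (l : List (Fin 3)) : (spell l).length ≤ l.length := by
  rw [spell, List.length_flatMap]
  simpa using List.sum_le_card_nsmul (l.map fun v => (vertexBits v).length) 1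
    (by simpa using fun v _ => length_vertexBits_le v)

theorem length_certificate_le {N : ℕ} {pos : Fin (N + 2) → Fin 3}
    (h : pos (Fin.last (N + 1)) = 2) : (certificate pos).length ≤ N := by
  have hspell : certificate pos = spell (List.ofFn fun i : Fin N => pos i.castSucc.succ) := by
    rw [certificate, List.ofFn_succ', List.concat_eq_append, spell, List.flatMap_append]
    simp [h, vertexBits, spell]
  rw [hspell]
  exact (length_spell_le _).trans_eq List.length_ofFn

/-- The vertex that spells a bit; `none` stands for the end of the string. -/
def bitVertex : Option Bool → Fin 3
  | some false => 0
  | some true => 1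
  | none => 2

theorem bitVertex_eq_two {o : Option Bool} : bitVertex o = 2 ↔ o = none := by
  rcases o with _ | _ | _ <;> simp [bitVertex]

theorem vertexBits_bitVertex_some (b : Bool) : vertexBits (bitVertex (some b)) = [b] := by
  cases b <;> rfl

theorem spell_ofFn_bitVertex {w : List Bool} {M : ℕ} (hM : w.length ≤ M) :
    spell (List.ofFn fun i : Fin M => bitVertex w[(i : ℕ)]?) = w := by
  induction w generalizing M with
  | nil => simp [spell, bitVertex, vertexBits]
  | cons b w ih =>
    obtain ⟨M, rfl⟩ := Nat.exists_eq_add_of_le' ((Nat.le_add_left 1 _).trans hM)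
    rw [List.ofFn_succ, spell, List.flatMap_cons]
    exact congrArg₂ _ (vertexBits_bitVertex_some b) (ih (Nat.le_of_succ_le_succ hM))

theorem exists_certificate_eq {N : ℕ} {w : List Bool} (hw : w.length ≤ N) :
    ∃ pos : Fin (N + 2) → Fin 3, pos 0 = 0 ∧ pos (Fin.last (N + 1)) = 2 ∧
      StaysAtExit pos ∧ certificate pos = w := by
  refine ⟨Fin.cons 0 fun i : Fin (N + 1) => bitVertex w[(i : ℕ)]?, rfl, ?_, .cons_zero ?_, ?_⟩
  · rw [← Fin.succ_last, Fin.cons_succ, bitVertex_eq_two]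
    exact List.getElem?_eq_none hw
  · intro i j hij h
    rw [bitVertex_eq_two, List.getElem?_eq_none_iff] at h ⊢
    exact h.trans (Fin.le_of_lt hij)
  · simp only [certificate, Fin.cons_succ]
    exact spell_ofFn_bitVertex (hw.trans N.le_succ)

/-- The positions of a person who moves from room `0` to the vertex `v` at time `1` and stays
there. -/
def moveTo (tmax : ℕ) (v : Fin 3) : Fin (tmax + 1) → Fin 3 := Fin.cons 0 fun _ => v

theorem isWES_moveTo (tmax : ℕ) (v : Fin 3) : IsWES (vertexSchedule (moveTo tmax v)) :=
  isWES_vertexSchedule (.cons_zero fun _ _ _ h => h)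

/-! ### Codes of schedules -/

/-- The code of the state in which the only person is at `v`. -/
def vertexCode (v : Fin 3) : List Symbol := encList (encLoc (G := certGraph)) [Sum.inl v]

theorem encSchedule_vertexSchedule {tmax : ℕ} (pos : Fin (tmax + 1) → Fin 3) :
    encSchedule (vertexSchedule pos) =
      .lpar :: (vertexCode (pos 0) ++
        ((List.ofFn fun i : Fin tmax => pos i.succ).flatMap vertexCode ++ [.rpar])) := by
  have hstate (t) : encState (vertexSchedule pos t) = vertexCode (pos t) := by
    simp [encState, vertexCode, vertexSchedule]
  have hcodes : (List.ofFn (vertexSchedule pos)).flatMap encState =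
      (List.ofFn pos).flatMap vertexCode := by
    simp only [List.flatMap_def, List.map_ofFn, Function.comp_def, hstate]
  rw [encSchedule, encList, hcodes, List.ofFn_succ, List.flatMap_cons, List.append_assoc]

theorem vertexCode_zero : vertexCode 0 = [.lpar, .zero, .lpar, .rpar, .rpar] := by
  simp [vertexCode, encList, encLoc, encNat, encBits]

theorem vertexCode_one : vertexCode 1 = [.lpar, .zero, .lpar, .one, .rpar, .rpar] := by
  simp [vertexCode, encList, encLoc, encNat, encBits, encBit]

theorem vertexCode_two : vertexCode 2 = [.lpar, .zero, .lpar, .zero, .one, .rpar, .rpar] := by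
  have hbits : Nat.bits 2 = [false, true] := by simp [Nat.bits, Nat.binaryRec]
  simp [vertexCode, encList, encLoc, encNat, encBits, encBit, hbits]

theorem length_vertexCode_le (v : Fin 3) : (vertexCode v).length ≤ 7 := by
  fin_cases v
  · exact (congrArg List.length vertexCode_zero).trans_le (by simp)
  · exact (congrArg List.length vertexCode_one).trans_le (by simp)
  · exact (congrArg List.length vertexCode_two).trans_le le_rfl

/-- The output by which a behavior program tells that the person moves to `v` with
probability `1`. -/
def outputCode (tmax : ℕ) (v : Fin 3) : List Symbol :=
  encList (fun es => encNat 1 ++ (encNat 1 ++ encSchedule es)) [vertexSchedule (moveTo tmax v)]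

/-- The part of `outputCode tmax v` that does not depend on `tmax` and `v`. -/
def outputPrefix : List Symbol :=
  .lpar :: (encNat 1 ++ (encNat 1 ++ (.lpar :: vertexCode 0)))

theorem outputCode_eq (tmax : ℕ) (v : Fin 3) : outputCode tmax v =
    outputPrefix ++ ((List.replicate tmax (vertexCode v)).flatten ++ [.rpar, .rpar]) := by
  simp [outputCode, outputPrefix, encList, encSchedule_vertexSchedule, moveTo,
    List.flatMap_replicate]

/-! ### The behavior program -/

/-- The stacks of the behavior program besides those of the simulated machine: the schedule, the
parameters, the output, a counter, and the reverse of a bit string. -/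
inductive Reg
  | sched
  | data
  | out
  | cnt
  | tmp
  deriving DecidableEq

/-- The alphabets of the stacks `Reg`. -/
abbrev RegAlphabet : Reg → Type
  | .sched => Symbol
  | .data => Bool
  | .out => Symbol
  | .cnt => Unit
  | .tmp => Bool

instance finite_regAlphabet : ∀ k, Finite (RegAlphabet k)
  | .sched => inferInstanceAs (Finite Symbol)
  | .data => inferInstanceAs (Finite Bool)
  | .out => inferInstanceAs (Finite Symbol)
  | .cnt => inferInstanceAs (Finite Unit)
  | .tmp => inferInstanceAs (Finite Bool)

/-- The contents of the stacks `Reg`. -/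
structure Regs where
  sched : List Symbol := []
  data : List Bool := []
  out : List Symbol := []
  cnt : ℕ := 0
  tmp : List Bool := []

/-- The store with the given contents; the counter is in unary. -/
def Regs.store (R : Regs) : Store RegAlphabet
  | .sched => R.sched
  | .data => R.data
  | .out => R.out
  | .cnt => List.replicate R.cnt ()
  | .tmp => R.tmp

/-- The alphabets of the behavior program that simulates the machine `tm`. -/
abbrev ProgAlphabet (tm : FinTM2) : Option tm.K ⊕ Reg → Type :=
  Sum.elim (MachineAlphabet tm) RegAlphabet

instance finite_progAlphabet (tm : FinTM2) : ∀ k, Finite (ProgAlphabet tm k)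
  | .inl k => finite_machineAlphabet tm k
  | .inr k => finite_regAlphabet k

section Program

variable {tm : FinTM2} (T : Store (MachineAlphabet tm)) (R : Regs)

/-- The store of the behavior program. -/
abbrev progStore : Store (ProgAlphabet tm) := T.sum R.store

theorem update_sched (l : List Symbol) :
    Function.update (progStore T R) (.inr .sched) l = progStore T { R with sched := l } := by
  rw [progStore, Store.update_inr]
  congr 1; funext k; cases k <;> rfl

theorem update_data (l : List Bool) :
    Function.update (progStore T R) (.inr .data) l = progStore T { R with data := l } := by
  rw [progStore, Store.update_inr]
  congr 1; funext k; cases k <;> rfl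

theorem update_out (l : List Symbol) :
    Function.update (progStore T R) (.inr .out) l = progStore T { R with out := l } := by
  rw [progStore, Store.update_inr]
  congr 1; funext k; cases k <;> rfl

theorem update_cnt (l : List Unit) :
    Function.update (progStore T R) (.inr .cnt) l = progStore T { R with cnt := l.length } := by
  rw [progStore, Store.update_inr]
  congr 1; funext k; cases k <;> first | rfl | exact List.eq_replicate_of_mem fun _ _ => rfl

theorem update_tmp (l : List Bool) :
    Function.update (progStore T R) (.inr .tmp) l = progStore T { R with tmp := l } := by
  rw [progStore, Store.update_inr]
  congr 1; funext k; cases k <;> rfl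

theorem update_machine (k : Option tm.K) (l l' : List (MachineAlphabet tm k)) :
    Function.update (progStore (.single k l) R) (.inl k) l' = progStore (.single k l') R := by
  rw [progStore, Store.update_inl, Store.single, Function.update_idem, Store.single]

theorem runsWithin_push_tmp (b : Bool) :
    RunsWithin (.push (.inr .tmp) b) (progStore T R) 1
      (progStore T { R with tmp := b :: R.tmp }) :=
  (RunsWithin.push (progStore T R) (.inr .tmp) b).congr rfl (update_tmp T R _) le_rfl

theorem runsWithin_push_machine (k : Option tm.K) (a : MachineAlphabet tm k)
    (l : List (MachineAlphabet tm k)) :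
    RunsWithin (.push (.inl k) a) (progStore (.single k l) R) 1
      (progStore (.single k (a :: l)) R) := by
  refine (RunsWithin.push (progStore (.single k l) R) (.inl k) a).congr rfl
    ((update_machine R k l _).trans ?_) le_rfl
  simp [Store.sum, Store.single]

theorem runsWithin_pushAll_out (l : List Symbol) :
    RunsWithin (.pushAll (.inr .out) l) (progStore T R) l.length
      (progStore T { R with out := l ++ R.out }) :=
  (runsWithin_pushAll (Γ := ProgAlphabet tm) (.inr .out) l (progStore T R)).congr rfl
    (update_out T R _) le_rfl

theorem runsWithin_push_cnt :
    RunsWithin (.push (.inr .cnt) ()) (progStore T R) 1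
      (progStore T { R with cnt := R.cnt + 1 }) := by
  refine (RunsWithin.push (progStore T R) (.inr .cnt) ()).congr rfl
    ((update_cnt T R _).trans ?_) le_rfl
  simp [Store.sum, Regs.store]

theorem runsWithin_pushAll_tmp (l : List Bool) :
    RunsWithin (.pushAll (.inr .tmp) l) (progStore T R) l.length
      (progStore T { R with tmp := l ++ R.tmp }) :=
  (runsWithin_pushAll (Γ := ProgAlphabet tm) (.inr .tmp) l (progStore T R)).congr rfl
    (update_tmp T R _) le_rfl

theorem runsWithin_pop_sched {R : Regs}
    {e : Cmd (ProgAlphabet tm)} {f : Symbol → Cmd (ProgAlphabet tm)}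
    {a : Symbol} {l : List Symbol} {t : ℕ} {S : Store (ProgAlphabet tm)}
    (h : RunsWithin (f a) (progStore T { R with sched := l }) t S) :
    RunsWithin (.pop (.inr .sched) e f) (progStore T { R with sched := a :: l }) (1 + t) S := by
  refine .pop_cons (Γ := ProgAlphabet tm) (k := .inr .sched) rfl ?_
  rwa [update_sched]

theorem runsWithin_pop_machine {R : Regs} {k : Option tm.K} {e : Cmd (ProgAlphabet tm)}
    {f : MachineAlphabet tm k → Cmd (ProgAlphabet tm)} {a : MachineAlphabet tm k}
    {l : List (MachineAlphabet tm k)} {t : ℕ} {S : Store (ProgAlphabet tm)}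
    (h : RunsWithin (f a) (progStore (.single k l) R) t S) :
    RunsWithin (.pop (.inl k) e f) (progStore (.single k (a :: l)) R) (1 + t) S := by
  refine .pop_cons (Γ := ProgAlphabet tm) (k := .inl k) (a := a) (r := l) ?_ ?_
  · simp [Store.sum, Store.single]
  · exact h.congr (update_machine ..) rfl le_rfl

/-- Remove `j` symbols from the schedule. -/
def dropCmd : ℕ → Cmd (ProgAlphabet tm)
  | 0 => .skip
  | j + 1 => .seq (.pop (.inr .sched) .skip fun _ => .skip) (dropCmd j)

theorem runsWithin_dropCmd (l s : List Symbol) :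
    RunsWithin (dropCmd l.length) (progStore T { R with sched := l ++ s }) l.length
      (progStore T { R with sched := s }) := by
  induction l with
  | nil => exact .skip _
  | cons a l ih =>
    exact ((runsWithin_pop_sched T (R := R) (.skip _)).seq ih).mono
      (by rw [List.length_cons]; omega)

/-- Record a visit to the vertex `v`. -/
def recordCmd (v : Fin 3) : Cmd (ProgAlphabet tm) :=
  .seq (.push (.inr .cnt) ()) (.pushAll (.inr .tmp) (vertexBits v))

theorem runsWithin_recordCmd (v : Fin 3) :
    RunsWithin (recordCmd v) (progStore T R) 2
      (progStore T { R with cnt := R.cnt + 1, tmp := vertexBits v ++ R.tmp }) :=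
  ((runsWithin_push_cnt T R).seq (runsWithin_pushAll_tmp T _ (vertexBits v))).mono
    (Nat.add_le_add_left (length_vertexBits_le v) 1)

/-- Read the rest of the code of a state, given the first symbol by which the three possible
codes differ. -/
def readVertexCmd : Symbol → Cmd (ProgAlphabet tm)
  | .rpar => .seq (dropCmd 1) (recordCmd 0)
  | .one => .seq (dropCmd 2) (recordCmd 1)
  | .zero => .seq (dropCmd 3) (recordCmd 2)
  | .lpar => .skip

/-- Read the rest of the code of a state, given its first symbol. -/
def readStateCmd : Symbol → Cmd (ProgAlphabet tm)
  | .lpar => .seq (dropCmd 2) (.pop (.inr .sched) .skip readVertexCmd)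
  | _ => .skip

theorem runsWithin_readStateCmd (v : Fin 3) (s : List Symbol) :
    ∃ r, vertexCode v = .lpar :: r ∧
      RunsWithin (readStateCmd .lpar) (progStore T { R with sched := r ++ s }) 8
        (progStore T { R with sched := s, cnt := R.cnt + 1, tmp := vertexBits v ++ R.tmp }) := by
  have hread (a : Symbol) (l : List Symbol) (hl : l.length ≤ 3)
      (ha : readVertexCmd (tm := tm) a = .seq (dropCmd l.length) (recordCmd v)) :
      RunsWithin (readStateCmd .lpar)
        (progStore T { R with sched := .zero :: .lpar :: a :: l ++ s }) 8
        (progStore T { R with sched := s, cnt := R.cnt + 1, tmp := vertexBits v ++ R.tmp }) := by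
    refine ((runsWithin_dropCmd T R [.zero, .lpar] (a :: l ++ s)).seq
      (runsWithin_pop_sched T (t := l.length + 2) ?_)).mono
      (by simp only [List.length_cons, List.length_nil]; omega)
    rw [ha]
    exact (runsWithin_dropCmd T R l s).seq (runsWithin_recordCmd T { R with sched := s } v)
  match v with
  | 0 => exact ⟨_, vertexCode_zero, hread .rpar [.rpar] (by simp) rfl⟩
  | 1 => exact ⟨_, vertexCode_one, hread .one [.rpar, .rpar] (by simp) rfl⟩
  | 2 => exact ⟨_, vertexCode_two, hread .zero [.one, .rpar, .rpar] (by simp) rfl⟩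

theorem runsWithin_readStates (vs : List (Fin 3)) :
    RunsWithin (.loop (.inr .sched) readStateCmd)
      (progStore T { R with sched := vs.flatMap vertexCode ++ [.rpar] }) (9 * vs.length + 2)
      (progStore T { R with
        sched := [], cnt := vs.length + R.cnt, tmp := (spell vs).reverse ++ R.tmp }) := by
  induction vs generalizing R with
  | nil =>
    refine (RunsWithin.loop_cons (Γ := ProgAlphabet tm) (k := .inr .sched) (a := Symbol.rpar)
      (r := []) (t := 0) rfl (.skip _) (.loop_nil (Function.update_self ..))).congr rfl
      ((update_sched ..).trans ?_) le_rfl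
    simp [spell]
  | cons v vs ih =>
    obtain ⟨r, hr, hv⟩ := runsWithin_readStateCmd T R v (vs.flatMap vertexCode ++ [.rpar])
    refine (RunsWithin.loop_cons (Γ := ProgAlphabet tm) (k := .inr .sched)
      (a := Symbol.lpar) (r := r ++ (vs.flatMap vertexCode ++ [.rpar])) ?_
      (hv.congr (update_sched ..) rfl le_rfl)
      (ih { R with cnt := R.cnt + 1, tmp := vertexBits v ++ R.tmp })).congr rfl ?_ ?_
    · simp [Store.sum, Regs.store, hr]
    · simp [spell, reverse_vertexBits, add_assoc, add_comm 1]
    · rw [List.length_cons]; omega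

theorem runsWithin_writeStates (v : Fin 3) (l : List Unit) (o : List Symbol) :
    RunsWithin (.loop (.inr .cnt) fun _ => .pushAll (.inr .out) (vertexCode v))
      (progStore T { cnt := l.length, out := o }) (8 * l.length + 1)
      (progStore T { out := (List.replicate l.length (vertexCode v)).flatten ++ o }) := by
  have hfold : l.foldl (fun o _ => vertexCode v ++ o) o =
      (List.replicate l.length (vertexCode v)).flatten ++ o := by
    induction l generalizing o with
    | nil => rfl
    | cons a l ih =>
      rw [List.foldl_cons, ih, List.length_cons, List.replicate_succ', List.flatten_concat,
        List.append_assoc]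
  rw [← hfold]
  exact RunsWithin.loop (Γ := ProgAlphabet tm) (k := .inr .cnt)
    (fun (l : List Unit) o => progStore T { cnt := l.length, out := o })
    (fun o _ => vertexCode v ++ o) (fun _ _ _ => update_cnt T _ _)
    (fun _ _ _ => (runsWithin_pushAll_out T _ _).mono (length_vertexCode_le v)) l o

/-- Write the output that tells that the person moves to `v`. -/
def writeCmd (v : Fin 3) : Cmd (ProgAlphabet tm) :=
  .seq (.pushAll (.inr .out) [.rpar, .rpar])
    (.seq (.loop (.inr .cnt) fun _ => .pushAll (.inr .out) (vertexCode v))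
      (.pushAll (.inr .out) outputPrefix))

theorem runsWithin_writeCmd (v : Fin 3) (tmax : ℕ) :
    RunsWithin (writeCmd v) (progStore T { cnt := tmax })
      (2 + ((8 * tmax + 1) + outputPrefix.length))
      (progStore T { out := outputCode tmax v }) := by
  have hstates := runsWithin_writeStates T v (List.replicate tmax ()) [.rpar, .rpar]
  have hprefix := runsWithin_pushAll_out T
    { out := (List.replicate tmax (vertexCode v)).flatten ++ [.rpar, .rpar] } outputPrefix
  rw [List.length_replicate] at hstates
  rw [← outputCode_eq] at hprefix
  exact (runsWithin_pushAll_out T { cnt := tmax } [.rpar, .rpar]).seq (hstates.seq hprefix)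

end Program

section Verifier

variable {tm : FinTM2} (e : tm.Γ tm.k₀ ≃ Option Bool)

/-- The symbol of the simulated input stack that stands for `o`. -/
def loadSymbol (o : Option Bool) : MachineAlphabet tm (some tm.k₀) := inputSymbol (e.symm o)

/-- Move the bits on the stack `tmp` to the input stack of the simulated machine. -/
def loadBitsCmd : Cmd (ProgAlphabet tm) :=
  .loop (.inr .tmp) fun b => .push (.inl (some tm.k₀)) (loadSymbol e (some b))

theorem runsWithin_loadBitsCmd (R : Regs) (w : List Bool) (y : List (Option Bool)) :
    RunsWithin (loadBitsCmd e)
      (progStore (.single (some tm.k₀) (y.map (loadSymbol e))) { R with tmp := w.reverse })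
      (2 * w.length + 1)
      (progStore (.single (some tm.k₀) ((w.map some ++ y).map (loadSymbol e)))
        { R with tmp := [] }) := by
  have hfold : w.reverse.foldl (fun y b => some b :: y) y = w.map some ++ y := by
    rw [List.foldl_reverse, List.foldr_cons_eq_append]
  rw [← List.length_reverse, ← hfold]
  exact RunsWithin.loop (Γ := ProgAlphabet tm) (k := .inr .tmp)
    (fun l y => progStore (.single (some tm.k₀) (y.map (loadSymbol e))) { R with tmp := l })
    (fun y b => some b :: y) (fun _ _ _ => update_tmp _ _ _)
    (fun b _ _ => runsWithin_push_machine _ _ (loadSymbol e (some b)) _) w.reverse y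

/-- Push the string `x#w` on the input stack of the simulated machine, where `x` is on the stack
`data` and the reverse of `w` is on the stack `tmp`. -/
def loadCmd : Cmd (ProgAlphabet tm) :=
  .seq (loadBitsCmd e) (.seq (.push (.inl (some tm.k₀)) (loadSymbol e none))
    (.seq (.loop (.inr .data) fun b => .push (.inr .tmp) b) (loadBitsCmd e)))

theorem runsWithin_loadCmd (n : ℕ) (x w : List Bool) :
    RunsWithin (loadCmd e)
      (progStore (.single (some tm.k₀) []) { data := x, cnt := n, tmp := w.reverse })
      ((2 * w.length + 1) + (1 + ((2 * x.length + 1) + (2 * x.length + 1))))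
      (progStore (.single (some tm.k₀) ((encPair (x, w)).map (loadSymbol e))) { cnt := n }) := by
  have hw := runsWithin_loadBitsCmd e { data := x, cnt := n } w []
  have hsep := runsWithin_push_machine { data := x, cnt := n } (some tm.k₀) (loadSymbol e none)
    ((w.map some).map (loadSymbol e))
  have hrev : x.foldl (fun t b => b :: t) [] = x.reverse := by
    rw [List.foldl_flip_cons_eq_append, List.map_id', List.append_nil]
  have hx := RunsWithin.loop (Γ := ProgAlphabet tm) (k := .inr .data)
    (fun l t => progStore (.single (some tm.k₀) ((none :: w.map some).map (loadSymbol e)))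
      { data := l, cnt := n, tmp := t })
    (fun t b => b :: t) (fun _ _ _ => update_data _ _ _)
    (fun b _ _ => runsWithin_push_tmp _ _ b) x []
  have hload := runsWithin_loadBitsCmd e { cnt := n } x (none :: w.map some)
  rw [List.append_nil] at hw
  exact hw.seq (hsep.seq ((hx.congr rfl (by rw [← hrev]; rfl) le_rfl).seq hload))

/-- The behavior program: run the verifier on the parameters and the certificate spelled by the
schedule, and send the person to the exit if it accepts. -/
noncomputable def behaviorCmd (e' : tm.Γ tm.k₁ ≃ Bool) : Cmd (ProgAlphabet tm) :=
  .seq (dropCmd 6) (.seq (.loop (.inr .sched) readStateCmd) (.seq (loadCmd e)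
    (.seq (machineCmd tm).inl
      (.pop (.inl (some tm.k₁)) .skip fun a => writeCmd (if e' a.1 then 2 else 0)))))

theorem runsWithin_behaviorCmd (e' : tm.Γ tm.k₁ ≃ Bool) (x : List Bool) {N : ℕ}
    {pos : Fin (N + 2) → Fin 3} (h0 : pos 0 = 0) {t : ℕ} {a : MachineAlphabet tm (some tm.k₁)}
    (h : RunsWithin (machineCmd tm)
      (.single (some tm.k₀) ((encPair (x, certificate pos)).map (loadSymbol e))) t
      (.single (some tm.k₁) [a])) :
    RunsWithin (behaviorCmd e e')
      (progStore (.single (some tm.k₀) [])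
        { sched := encSchedule (vertexSchedule pos), data := x })
      (6 + ((9 * (N + 1) + 2) + (((2 * (certificate pos).length + 1) +
        (1 + ((2 * x.length + 1) + (2 * x.length + 1)))) +
          (t + (1 + (2 + ((8 * (N + 1) + 1) + outputPrefix.length)))))))
      (progStore (.single (some tm.k₁) [])
        { out := outputCode (N + 1) (if e' a.1 then 2 else 0) }) := by
  let vs := List.ofFn fun i : Fin (N + 1) => pos i.succ
  have hvs : vs.length = N + 1 := List.length_ofFn
  have hcode : encSchedule (vertexSchedule pos) =
      (.lpar :: vertexCode 0) ++ (vs.flatMap vertexCode ++ [.rpar]) := by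
    rw [encSchedule_vertexSchedule, h0, List.cons_append]
  have hlen : (.lpar :: vertexCode 0).length = 6 := by rw [vertexCode_zero]; rfl
  have hdrop := runsWithin_dropCmd (.single (some tm.k₀) []) { data := x }
    (.lpar :: vertexCode 0) (vs.flatMap vertexCode ++ [.rpar])
  have hread := runsWithin_readStates (.single (some tm.k₀) []) { data := x } vs
  have hload := runsWithin_loadCmd e (N + 1) x (certificate pos)
  have hwrite := runsWithin_writeCmd (.single (some tm.k₁) []) (if e' a.1 then 2 else 0) (N + 1)
  rw [hlen, ← hcode] at hdrop
  simp only [hvs, List.append_nil, add_zero] at hread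
  exact hdrop.seq (hread.seq (hload.seq ((h.inl _).seq (runsWithin_pop_machine hwrite))))

end Verifier

section Polynomial

variable {verify : List Bool × List Bool → Bool}

theorem exists_runsWithin_verifier
    (M : TM2ComputableInPolyTime encPair Computability.encodeBool verify) :
    ∃ c : ℕ, ∀ xw, ∃ a : MachineAlphabet M.tm (some M.tm.k₁),
      M.outputAlphabet a.1 = verify xw ∧
      RunsWithin (machineCmd M.tm)
        (.single (some M.tm.k₀) ((encPair xw).map (loadSymbol M.inputAlphabet)))
        (c * M.time.eval (encPair xw).length + 2) (.single (some M.tm.k₁) [a]) := by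
  obtain ⟨c, hc⟩ := exists_runsWithin_machineCmd M.tm
  refine ⟨c, fun xw => ?_⟩
  obtain ⟨y, hy, h⟩ := hc _ _ _ (M.outputsFun xw)
  obtain ⟨a, rfl, ha⟩ := List.map_eq_singleton_iff.1 hy
  refine ⟨a, ((Equiv.symm_apply_eq _).1 ha.symm).symm, ?_⟩
  rwa [List.map_map] at h

theorem polynomial_eval_mono (p : Polynomial ℕ) : Monotone fun n => p.eval n := fun a b h => by
  simp only [Polynomial.eval_eq_sum, Polynomial.sum]
  gcongr

theorem exists_runsWithin_behaviorCmd
    (M : TM2ComputableInPolyTime encPair Computability.encodeBool verify) (p : Polynomial ℕ) :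
    ∃ q : Polynomial ℕ, ∀ (x : List Bool) (pos : Fin (p.eval x.length + 2) → Fin 3),
      pos 0 = 0 → pos (Fin.last _) = 2 →
      RunsWithin (behaviorCmd M.inputAlphabet M.outputAlphabet)
        (progStore (.single (some M.tm.k₀) [])
          { sched := encSchedule (vertexSchedule pos), data := x })
        (q.eval x.length)
        (progStore (.single (some M.tm.k₁) []) {
          out := outputCode (p.eval x.length + 1)
            (if verify (x, certificate pos) = true then 2 else 0) }) := by
  obtain ⟨c, hc⟩ := exists_runsWithin_verifier M
  refine ⟨6 + ((9 * (p + 1) + 2) + (((2 * p + 1) + (1 + ((2 * .X + 1) + (2 * .X + 1)))) +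
    ((.C c * M.time.comp (.X + 1 + p) + 2) +
      (1 + (2 + ((8 * (p + 1) + 1) + .C outputPrefix.length)))))), fun x pos h0 hlast => ?_⟩
  obtain ⟨a, ha, hverify⟩ := hc (x, certificate pos)
  have hcert := length_certificate_le hlast
  have hpair : (encPair (x, certificate pos)).length ≤ x.length + 1 + p.eval x.length := by
    simp only [encPair, List.length_append, List.length_cons, List.length_map]
    omega
  have htime := Nat.mul_le_mul_left c (polynomial_eval_mono M.time hpair)
  rw [← ha]
  refine (runsWithin_behaviorCmd _ M.outputAlphabet x h0 hverify).mono ?_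
  simp only [Polynomial.eval_add, Polynomial.eval_mul, Polynomial.eval_comp, Polynomial.eval_X,
    Polynomial.eval_C, Polynomial.eval_one, Polynomial.eval_ofNat]
  dsimp only at htime
  omega

end Polynomial

section Numbering

variable (tm : FinTM2)

instance finite_stackIndex : Finite tm.K :=
  have := tm.kFin
  inferInstance

/-- The numbers of the stacks of the behavior program. -/
noncomputable def progStack : Option tm.K ⊕ Reg → ℕ
  | .inr .sched => 0
  | .inr .data => 1
  | .inr .out => 2
  | .inr .cnt => 3
  | .inr .tmp => 4
  | .inl k => 5 + Finite.equivFin (Option tm.K) k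

/-- The numbers of the symbols of the behavior program. -/
noncomputable def progSymbol : ∀ k, ProgAlphabet tm k → ℕ
  | .inr .sched => Symbol.toNat
  | .inr .data => Bool.toNat
  | .inr .out => Symbol.toNat
  | .inr .cnt => fun _ => 0
  | .inr .tmp => Bool.toNat
  | .inl k => fun a => Finite.equivFin (MachineAlphabet tm k) a

/-- The numbering of the stacks and the symbols of the behavior program, in accordance with the
conventions about input and output. -/
noncomputable def progNumbering : Numbering (ProgAlphabet tm) where
  stack := progStack tm
  symbol := progSymbol tm
  stack_injective := by
    rintro (k | k) (l | l) h
    · simp only [progStack] at h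
      simpa [Fin.val_inj] using h
    · cases l <;> simp only [progStack] at h <;> omega
    · cases k <;> simp only [progStack] at h <;> omega
    · cases k <;> cases l <;> simp_all [progStack]
  symbol_injective := by
    rintro (k | (_ | _ | _ | _ | _))
    · exact Fin.val_injective.comp (Finite.equivFin _).injective
    · exact Symbol.toNat_injective
    · exact (by decide : Function.Injective Bool.toNat)
    · exact Symbol.toNat_injective
    · exact fun _ _ _ => rfl
    · exact (by decide : Function.Injective Bool.toNat)

theorem represents_init (code : List Instr) (x : List Bool) (t : ℕ) (input : List Symbol) :
    (progNumbering tm).Represents (BehaviorCode.init ⟨code, x, t⟩ input).stk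
      (progStore (.single (some tm.k₀) []) { sched := input, data := x }) := by
  rintro (k | (_ | _ | _ | _ | _))
  · have h0 : progStack tm (.inl k) ≠ 0 := by simp [progStack]
    have h1 : progStack tm (.inl k) ≠ 1 := by simp only [progStack]; omega
    simp [progNumbering, BehaviorCode.init, Store.sum, Store.single, h0, h1]
    rfl
  all_goals rfl

end Numbering

theorem exists_behaviorCode {verify : List Bool × List Bool → Bool}
    (M : TM2ComputableInPolyTime encPair Computability.encodeBool verify) (p : Polynomial ℕ) :
    ∃ (code : List Instr) (q : Polynomial ℕ), ∀ (x : List Bool)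
      (pos : Fin (p.eval x.length + 2) → Fin 3), pos 0 = 0 → pos (Fin.last _) = 2 →
      BehaviorCode.Outputs ⟨code, x, q.eval x.length⟩ (encSchedule (vertexSchedule pos))
        (outputCode (p.eval x.length + 1)
          (if verify (x, certificate pos) = true then 2 else 0)) := by
  obtain ⟨q, hq⟩ := exists_runsWithin_behaviorCmd M p
  obtain ⟨start, hstart⟩ : ∃ start,
      (behaviorCmd M.inputAlphabet M.outputAlphabet).entry = some start := ⟨_, rfl⟩
  obtain ⟨code, hcode⟩ := FlowGraph.exists_code
    (Cmd.flow (c := behaviorCmd M.inputAlphabet M.outputAlphabet)) (progNumbering M.tm) start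
  refine ⟨code, q, fun x pos h0 hlast => ?_⟩
  have hrun := (hq x pos h0 hlast).reachesWithin
  rw [hstart] at hrun
  obtain ⟨hhalt, hstacks⟩ := hcode _ _ _ _ hrun (represents_init M.tm code x (q.eval x.length) _)
  exact ⟨hhalt, hstacks (.inr .out)⟩

/-! ### The reduction -/

/-- The initial state: the person is in room `0`. -/
def startState : State certGraph (Fin 1) := fun _ => Sum.inl 0

/-- The schedule in which the person moves to `v` at time `1` and stays there. -/
def moveWES (tmax : ℕ) (v : Fin 3) : WES certGraph startState tmax :=
  ⟨vertexSchedule (moveTo tmax v), isWES_moveTo tmax v, rfl⟩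

open Classical in
/-- The behavior model in which the person goes to the exit at once if the certificate spelled by
the given schedule is accepted by `accept`, and stays in the room otherwise. -/
noncomputable def certBehavior (N : ℕ) (accept : List Bool → Bool) :
    BehaviorModel certGraph startState (N + 1) := fun es =>
  ⟨Pi.single (moveWES (N + 1) (if accept (certificate (positions es.1)) = true then 2 else 0)) 1,
    single_mem_stdSimplex ℝ _⟩

/-- The instance that asks for a certificate of length at most `N` that is accepted by
`accept`. -/
noncomputable def certInstance (N : ℕ) (accept : List Bool → Bool) : Instance where
  n := 3
  m := 1
  tmax := N + 1
  G := certGraph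
  exit_capacity _ _ := le_rfl
  s₀ := startState
  β := certBehavior N accept
  D := 1
  K := 1
  K_le := le_rfl

theorem numEvacuated_moveTo (N : ℕ) (v : Fin 3) :
    numEvacuated (vertexSchedule (moveTo (N + 1) v)) 1 = if v = 2 then 1 else 0 := by
  have hexit (p) : (∃ u ∈ certGraph.EX, vertexSchedule (moveTo (N + 1) v) 1 p = Sum.inl u) ↔
      v = 2 := by
    simp [certGraph, vertexSchedule, moveTo]
  simp only [numEvacuated, hexit]
  split <;> simp_all

theorem expectedEvacuated_certBehavior (N : ℕ) (accept : List Bool → Bool)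
    (es : SES certGraph startState (N + 1)) :
    expectedEvacuated (certBehavior N accept) es 1 =
      if accept (certificate (positions es.1)) = true then 1 else 0 := by
  classical
  simp only [expectedEvacuated, certBehavior, Pi.single_apply, ite_mul, one_mul, zero_mul,
    Finset.sum_ite_eq', Finset.mem_univ, if_true]
  rw [moveWES, numEvacuated_moveTo]
  split <;> simp

theorem isYes_certInstance_iff {N : ℕ} {accept : List Bool → Bool} :
    (certInstance N accept).IsYes ↔ ∃ w : List Bool, w.length ≤ N ∧ accept w = true := by
  have haccept (es : SES certGraph startState (N + 1)) :
      ((1 : ℕ) : ℝ) ≤ expectedEvacuated (certBehavior N accept) es 1 ↔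
        accept (certificate (positions es.1)) = true := by
    rw [expectedEvacuated_certBehavior]
    split <;> simp_all
  refine (exists_congr haccept).trans ⟨?_, ?_⟩
  · rintro ⟨⟨es, hes, _⟩, h⟩
    exact ⟨_, length_certificate_le hes.positions_last, h⟩
  · rintro ⟨w, hw, h⟩
    obtain ⟨pos, h0, hlast, hexit, rfl⟩ := exists_certificate_eq hw
    exact ⟨⟨vertexSchedule pos, isSES_vertexSchedule hexit hlast,
      funext fun _ => congrArg Sum.inl h0⟩, h⟩

theorem describes_certBehavior {B : BehaviorCode} {N : ℕ} {accept : List Bool → Bool}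
    (h : ∀ pos : Fin (N + 2) → Fin 3, pos 0 = 0 → pos (Fin.last _) = 2 →
      B.Outputs (encSchedule (vertexSchedule pos))
        (outputCode (N + 1) (if accept (certificate pos) = true then 2 else 0))) :
    B.Describes (certBehavior N accept) := by
  rintro ⟨es, hes, hs⟩
  have h0 : positions es 0 = 0 := by
    rw [positions, hs]
    rfl
  refine ⟨[(1, moveWES (N + 1) (if accept (certificate (positions es)) = true then 2 else 0))],
    ?_, fun w => ?_⟩
  · have hout := h (positions es) h0 hes.positions_last
    rw [← hes.eq_vertexSchedule] at hout
    simpa [outputCode, encList, moveWES] using hout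
  · classical
    change (Pi.single (moveWES (N + 1) _) 1 : WES certGraph startState (N + 1) → ℝ) w = _
    rw [Pi.single_apply]
    simp only [List.map_cons, List.map_nil, List.sum_cons, List.sum_nil, add_zero, NNRat.cast_one]
    exact if_congr eq_comm rfl rfl

theorem enc_certInstance (N : ℕ) (accept : List Bool → Bool) (code : List Instr) (x : List Bool)
    (t : ℕ) : (certInstance N accept).enc ⟨code, x, t⟩ =
      (encGraph certGraph ++ encState startState) ++ (encUnary (N + 1) ++
        ((encNat 1 ++ (encNat 1 ++ encList encInstr code)) ++ (encBits x ++ encUnary t))) := by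
  simp [Instance.enc, certInstance, BehaviorCode.enc]

theorem printable_enc_certInstance (p q : Polynomial ℕ) (accept : List Bool → List Bool → Bool)
    (code : List Instr) :
    Printable fun x =>
      (certInstance (p.eval x.length) (accept x)).enc ⟨code, x, q.eval x.length⟩ := by
  simp only [enc_certInstance]
  have htmax := Printable.encUnary (p + 1)
  simp only [Polynomial.eval_add, Polynomial.eval_one] at htmax
  exact (Printable.const _).append (htmax.append
    ((Printable.const _).append (Printable.encBits.append (Printable.encUnary q))))

end Evac

theorem mainTheorem1 : Evac.NPHard Evac.DEP := by
  rintro L ⟨p, verify, ⟨M⟩, hL⟩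
  obtain ⟨code, q, hcode⟩ := Evac.exists_behaviorCode M p
  have hdesc (x : List Bool) : Evac.BehaviorCode.Describes ⟨code, x, q.eval x.length⟩
      (Evac.certBehavior (p.eval x.length) fun w => verify (x, w)) :=
    Evac.describes_certBehavior (hcode x)
  refine ⟨_, (Evac.printable_enc_certInstance p q (fun x w => verify (x, w)) code).polyTime,
    fun x => ?_⟩
  rw [hL, ← Evac.isYes_certInstance_iff (accept := fun w => verify (x, w))]
  constructor
  · exact fun hyes => ⟨_, _, hdesc x, rfl, hyes⟩
  · rintro ⟨I, B, hB, henc, hyes⟩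
    rwa [← Evac.Instance.eq_of_enc_eq hB (hdesc x) henc]
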